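/- **Theorem (uniqueness and stability).** Let $N\ge 1$, $\delta>0$, $\kappa>0$, $0<\alpha<1$, let $B_\delta$ be the open ball of radius $\delta$ about $0$ in $\mathbb R^N$, and let $\Omega=(\mathbb R^N\setminus\{0\})\times\mathbb R^N$. Let $f\in C^1(\Omega;\mathbb R^N)$ satisfy $f(-y,-u)=-f(y,u)$ on $\Omega$ and $f=\nabla_u\Phi$ for some $\Phi\in C^2(\Omega)$ of the form $$\Phi(y,u)=\kappa\frac{|u|^2}{|y|^{N+2\alpha}}+\Psi(y,u),\qquad \Psi(y,0)=0\le\Psi(y,u),\qquad |\nabla_u\Psi(y,u)|,\ |D_u^2\Psi(y,u)|\le g(y)\quad\text{on }\Omega,$$ with $g\ge 0$, $g\in L^2_{\rm loc}(\mathbb R^N)$. For $w:\mathbb R^N\to\mathbb R^N$ put $$[w]^2=\int_{\mathbb R^N}\int_{B_\delta}\frac{|w(x)-w(x-y)|^2}{|y|^{N+2\alpha}}\,dy\,dx,\qquad \|w\|_{\mathcal W}=\|w\|_{L^2}+[w].$$ Consider the Cauchy problem $\partial_{tt}u=Ku$ in $\mathbb R^N\times(0,\infty)$, $u(\cdot,0)=u_0$,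 $\partial_tu(\cdot,0)=v_0$, where $(Ku)(x)=\int_{B_\delta(x)}f(x'-x,u(x')-u(x))\,dx'$ is understood, for $u,v\in\mathcal W$, through the absolutely convergent energetic pairing $$\int_{\mathbb R^N}(Ku)\cdot v\,dx:=-\frac12\int_{\mathbb R^N}\int_{B_\delta}f\big(y,u(x)-u(x-y)\big)\cdot\big(v(x)-v(x-y)\big)\,dy\,dx .$$ A weak solution is a (measurable) function $u:\mathbb R^N\times[0,\infty)\to\mathbb R^N$ with $u\in L^\infty(0,T;\mathcal W)$ for every $T>0$ and weak time derivative $\partial_tu\in L^\infty(0,\infty;L^2(\mathbb R^N;\mathbb R^N))$ such that for every $v\in C_c^\infty(\mathbb R^{N+1};\mathbb R^N)$ $$\int_0^\infty\!\!\int_{\mathbb R^N}\big(u\cdot\partial_{tt}v-(Ku(\cdot,t))\cdot v\big)\,dx\,dt-\int_{\mathbb R^N}v_0\cdot v(\cdot,0)\,dx+\int_{\mathbb R^N}u_0\cdot\partial_tv(\cdot,0)\,dx=0 .$$ Let $u$ and $\tilde u$ be weak solutions with initial data $(u_0,v_0)$ and $(\tilde u_0,\tilde v_0)$ of finite energy,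 that is, $u_0,v_0,\tilde u_0,\tilde v_0\in L^2(\mathbb R^N;\mathbb R^N)$ and $$\int_{\mathbb R^N}\int_{B_\delta}\Phi\big(y,u_0(x)-u_0(x-y)\big)\,dy\,dx<\infty,\qquad \int_{\mathbb R^N}\int_{B_\delta}\Phi\big(y,\tilde u_0(x)-\tilde u_0(x-y)\big)\,dy\,dx<\infty .$$ Then $u$ and $\tilde u$ agree, for almost every $t>0$ and as elements of $L^2(\mathbb R^N;\mathbb R^N)$, with functions in $C([0,\infty);L^2(\mathbb R^N;\mathbb R^N))$; these representatives (again denoted $u,\tilde u$) are differentiable in $L^2$ at every $t>0$, and for every $t>0$ $$\|\partial_tu(\cdot,t)-\partial_t\tilde u(\cdot,t)\|_{L^2}^2+\kappa\,[u(\cdot,t)-\tilde u(\cdot,t)]^2\le e^{(\lambda+\frac1\kappa)t}\Big(\|v_0-\tilde v_0\|_{L^2}^2+\kappa\,[u_0-\tilde u_0]^2\Big),\qquad \lambda=\int_{B_\delta}g(y)^2|y|^{N+2\alpha}\,dy .$$ In particular, weak solutions are unique: if $u_0=\tilde u_0$ and $v_0=\tilde v_0$ almost everywhere, then $u=\tilde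 u$ almost everywhere in $\mathbb R^N\times(0,\infty)$. -/

import Mathlib

open MeasureTheory Set
open scoped ENNReal NNReal

noncomputable section

namespace Peridynamics

/-- The Euclidean space `ℝ^N`. -/
abbrev Space (N : ℕ) : Type := EuclideanSpace ℝ (Fin N)

/-- The constitutive assumptions on the pairwise force `f`, with exponent `p = 2`.
The functions `f`, `Φ`, `Ψ` only matter on `Ω = (ℝ^N ∖ {0}) × ℝ^N`;
their values at `y = 0` are irrelevant. -/
structure ForceAssumptions (N : ℕ) (κ α : ℝ) (f : Space N → Space N → Space N)
    (Φ Ψ : Space N → Space N → ℝ) (g : Space N → ℝ) : Prop where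
  kappa_pos : 0 < κ
  alpha_pos : 0 < α
  alpha_lt_one : α < 1
  /-- `f ∈ C¹(Ω; ℝ^N)`. -/
  force_contDiffOn :
    ContDiffOn ℝ 1 (Function.uncurry f) ({y : Space N | y ≠ 0} ×ˢ univ)
  /-- `f(-y, -u) = -f(y, u)`. -/
  force_odd : ∀ y : Space N, y ≠ 0 → ∀ u : Space N, f (-y) (-u) = -f y u
  /-- `Φ ∈ C²(Ω)`. -/
  potential_contDiffOn :
    ContDiffOn ℝ 2 (Function.uncurry Φ) ({y : Space N | y ≠ 0} ×ˢ univ)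
  /-- `f = ∇_u Φ`. -/
  force_eq_gradient : ∀ y : Space N, y ≠ 0 → ∀ u : Space N, HasGradientAt (Φ y) (f y u) u
  /-- `Φ(y, u) = κ |u|² / |y|^(N + 2α) + Ψ(y, u)`. -/
  potential_eq : ∀ y : Space N, y ≠ 0 → ∀ u : Space N,
    Φ y u = κ * ‖u‖ ^ 2 / ‖y‖ ^ ((N : ℝ) + 2 * α) + Ψ y u
  psi_zero : ∀ y : Space N, y ≠ 0 → Ψ y 0 = 0
  psi_nonneg : ∀ y : Space N, y ≠ 0 → ∀ u : Space N, 0 ≤ Ψ y u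
  /-- `|∇_u Ψ(y, u)| ≤ g(y)`. -/
  gradient_psi_le : ∀ y : Space N, y ≠ 0 → ∀ u : Space N, ‖gradient (Ψ y) u‖ ≤ g y
  /-- `|D²_u Ψ(y, u)| ≤ g(y)`, with the operator norm of the Hessian. -/
  hessian_psi_le : ∀ y : Space N, y ≠ 0 → ∀ u : Space N,
    ‖fderiv ℝ (gradient (Ψ y)) u‖ ≤ g y
  g_nonneg : ∀ y : Space N, 0 ≤ g y
  /-- `g ∈ L²_loc(ℝ^N)`. -/
  g_locL2 : ∀ C : Set (Space N), IsCompact C → MemLp g 2 (volume.restrict C)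

/-- `∫_{ℝ^N} ∫_{B_δ(0)} |w(x) - w(x - y)|² / |y|^(N + 2α) dy dx`, in `[0, ∞]`. -/
def nonlocalEnergy {N : ℕ} (δ α : ℝ) (w : Space N → Space N) : ℝ≥0∞ :=
  ∫⁻ x : Space N, ∫⁻ y in Metric.ball (0 : Space N) δ,
    ENNReal.ofReal (‖w x - w (x - y)‖ ^ 2 / ‖y‖ ^ ((N : ℝ) + 2 * α))

/-- The norm of the space `𝓦` (for `p = 2`), in `[0, ∞]`:
`‖w‖_{L²} + (∫∫ |w(x) - w(x - y)|² / |y|^(N + 2α))^(1/2)`. -/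
def wNorm {N : ℕ} (δ α : ℝ) (w : Space N → Space N) : ℝ≥0∞ :=
  eLpNorm w 2 volume + nonlocalEnergy δ α w ^ (1 / 2 : ℝ)

/-- Finite-energy initial data: `u₀, v₀ ∈ L²` and
`∫_{ℝ^N} ∫_{B_δ(0)} Φ(y, u₀(x) - u₀(x - y)) dy dx < ∞` (recall that `Φ ≥ 0`). -/
structure FiniteEnergyData {N : ℕ} (δ : ℝ) (Φ : Space N → Space N → ℝ)
    (u₀ v₀ : Space N → Space N) : Prop where
  memLp_u₀ : MemLp u₀ 2 volume
  memLp_v₀ : MemLp v₀ 2 volume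
  energy_lt_top :
    (∫⁻ x : Space N, ∫⁻ y in Metric.ball (0 : Space N) δ,
      ENNReal.ofReal (Φ y (u₀ x - u₀ (x - y)))) < ∞

/-- Test functions: `φ ∈ C^∞(ℝ^{N+1}; ℝ^N)` with compact support; `φ t x` is the value at
time `t` and position `x`. -/
structure IsTestFunction {N : ℕ} (φ : ℝ → Space N → Space N) : Prop where
  smooth : ContDiff ℝ (⊤ : ℕ∞) (Function.uncurry φ)
  compact : HasCompactSupport (Function.uncurry φ)

/-- Measurability of a function on `(0, ∞) × ℝ^N` (up to null sets). -/
def SpaceTimeMeasurable {N : ℕ} (u : ℝ → Space N → Space N) : Prop :=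
  AEStronglyMeasurable (Function.uncurry u) ((volume.restrict (Ioi (0 : ℝ))).prod volume)

/-- `z` is the weak (distributional) time derivative of `u` on `(0, ∞) × ℝ^N`. -/
def IsWeakTimeDeriv {N : ℕ} (u z : ℝ → Space N → Space N) : Prop :=
  ∀ φ : ℝ → Space N → Space N, IsTestFunction φ →
    tsupport (Function.uncurry φ) ⊆ Ioi (0 : ℝ) ×ˢ (univ : Set (Space N)) →
    ∫ t in Ioi (0 : ℝ), ∫ x, inner ℝ (u t x) (deriv (fun s => φ s x) t)
      = -∫ t in Ioi (0 : ℝ), ∫ x, inner ℝ (z t x) (φ t x)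

/-- The space `𝓧`: `u ∈ L^∞(0, T; 𝓦)` for every `T > 0` and
`∂_t u ∈ L^∞(0, ∞; L²(ℝ^N; ℝ^N))`. -/
structure MemX {N : ℕ} (δ α : ℝ) (u : ℝ → Space N → Space N) : Prop where
  measurable : SpaceTimeMeasurable u
  bounded : ∀ T : ℝ, 0 < T → ∃ C : ℝ≥0,
    ∀ᵐ t ∂volume.restrict (Ioo (0 : ℝ) T), wNorm δ α (u t) ≤ C
  timeDeriv : ∃ z : ℝ → Space N → Space N, SpaceTimeMeasurable z ∧ IsWeakTimeDeriv u z ∧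
    ∃ C : ℝ≥0, ∀ᵐ t ∂volume.restrict (Ioi (0 : ℝ)), eLpNorm (z t) 2 volume ≤ C

/-- The peridynamic operator as a pointwise integral,
`(Ku)(x) = ∫_{B_δ(x)} f(x' - x, u(x') - u(x)) dx'`. -/
def peridynamicOp {N : ℕ} (δ : ℝ) (f : Space N → Space N → Space N)
    (u : Space N → Space N) (x : Space N) : Space N :=
  ∫ x' in Metric.ball x δ, f (x' - x) (u x' - u x)

/-- The pairing `∫_{ℝ^N} (Ku) · v dx` of the peridynamic operator with `v`, in the energetic form
`-(1/2) ∫_{ℝ^N} ∫_{B_δ(0)} f(y, u(x) - u(x - y)) · (v(x) - v(x - y)) dy dx`.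
For `u, v ∈ 𝓦` this double integral converges absolutely, whereas the pointwise integral
`peridynamicOp` need not converge (the kernel is too singular).  Where the pointwise integral does
converge, the two agree: see `integral_inner_peridynamicOp`. -/
def pairingK {N : ℕ} (δ : ℝ) (f : Space N → Space N → Space N) (u v : Space N → Space N) : ℝ :=
  -(1 / 2) * ∫ x : Space N, ∫ y in Metric.ball (0 : Space N) δ,
    inner ℝ (f y (u x - u (x - y))) (v x - v (x - y))

/-- Consistency of `pairingK` with the pointwise operator: if the integrals involved converge
absolutely, then `∫ (Ku) · v dx` is the energetic pairing. -/
theorem integral_inner_peridynamicOp {N : ℕ} (δ : ℝ) (f : Space N → Space N → Space N)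
    (hodd : ∀ y : Space N, y ≠ 0 → ∀ u : Space N, f (-y) (-u) = -f y u)
    (u v : Space N → Space N)
    (h₁ : ∀ᵐ x : Space N, IntegrableOn (fun y => f y (u x - u (x - y)))
      (Metric.ball (0 : Space N) δ))
    (h₂ : Integrable (fun p : Space N × Space N => inner ℝ (f p.2 (u p.1 - u (p.1 - p.2))) (v p.1))
      ((volume : Measure (Space N)).prod (volume.restrict (Metric.ball (0 : Space N) δ)))) :
    ∫ x, inner ℝ (peridynamicOp δ f u x) (v x) = pairingK δ f u v := by
  set B := Metric.ball (0 : Space N) δ with hB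
  -- the case of dimension zero
  rcases subsingleton_or_nontrivial (Space N) with hN | hN
  · have h0 : ∀ a b : Space N, inner ℝ a b = 0 := fun a b => by
      rw [Subsingleton.elim a 0, inner_zero_left]
    simp [pairingK, h0]
  have hne : ∀ᵐ y : Space N, y ≠ 0 := by
    simp [ae_iff]
  -- rewrite the operator as an integral over the ball around the origin
  have hK : ∀ x, peridynamicOp δ f u x = -∫ y in B, f y (u x - u (x - y)) := by
    intro x
    have hmp : MeasurePreserving (fun y : Space N => x - y) volume volume :=
      Measure.measurePreserving_sub_left volume x
    have hpre : (fun y : Space N => x - y) ⁻¹' Metric.ball x δ = B := by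
      ext y; simp [hB, dist_eq_norm]
    have hemb : MeasurableEmbedding (fun y : Space N => x - y) :=
      (MeasurableEquiv.subLeft x).measurableEmbedding
    rw [peridynamicOp, ← hmp.setIntegral_preimage_emb hemb, hpre, ← integral_neg]
    refine integral_congr_ae (ae_restrict_of_ae ?_)
    filter_upwards [hne] with y hy
    have := hodd y hy (u x - u (x - y))
    rw [← this]
    simp
  set F : Space N × Space N → ℝ := fun p => inner ℝ (f p.2 (u p.1 - u (p.1 - p.2))) (v p.1)
    with hF
  set G : Space N × Space N → ℝ :=
    fun p => inner ℝ (f p.2 (u p.1 - u (p.1 - p.2))) (v (p.1 - p.2)) with hG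
  set μ : Measure (Space N × Space N) := (volume : Measure (Space N)).prod (volume.restrict B)
    with hμ
  -- the change of variables `(x, y) ↦ (x - y, -y)`
  have hneg : MeasurePreserving (fun y : Space N => -y) (volume.restrict B)
      (volume.restrict B) := by
    have := (Measure.measurePreserving_neg (volume : Measure (Space N))).restrict_preimage
      (s := B) Metric.isOpen_ball.measurableSet
    have hp : (Neg.neg : Space N → Space N) ⁻¹' B = B := by ext y; simp [hB]
    rwa [hp] at this
  have hS : MeasurePreserving (fun p : Space N × Space N => (p.1 - p.2, -p.2)) μ μ := by
    have hsk : MeasurePreserving (fun p : Space N × Space N => (-p.1, p.2 - p.1))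
        ((volume.restrict B).prod volume) ((volume.restrict B).prod volume) :=
      hneg.skew_product (g := fun y x => x - y) (by fun_prop)
        (Filter.Eventually.of_forall fun y => (measurePreserving_sub_right volume y).map_eq)
    have h3 := (Measure.measurePreserving_swap (μ := volume.restrict B)
      (ν := (volume : Measure (Space N)))).comp (hsk.comp
        (Measure.measurePreserving_swap (μ := (volume : Measure (Space N)))
          (ν := volume.restrict B)))
    exact h3
  have hSe : MeasurableEmbedding (fun p : Space N × Space N => (p.1 - p.2, -p.2)) := by
    refine MeasurableEquiv.measurableEmbedding
      { toFun := fun p : Space N × Space N => (p.1 - p.2, -p.2)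
        invFun := fun p : Space N × Space N => (p.1 - p.2, -p.2)
        left_inv := fun p => by simp
        right_inv := fun p => by simp
        measurable_toFun := ?_
        measurable_invFun := ?_ }
    all_goals
      change Measurable fun p : Space N × Space N => (p.1 - p.2, -p.2)
      fun_prop
  have hFS : (fun p => F (p.1 - p.2, -p.2)) =ᵐ[μ] fun p => -G p := by
    have h2 : ∀ᵐ p ∂μ, p.2 ≠ 0 := by
      have := (Measure.quasiMeasurePreserving_snd (μ := (volume : Measure (Space N)))
        (ν := volume.restrict B)).ae (ae_restrict_of_ae (s := B) hne)
      exact this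
    filter_upwards [h2] with p hp
    have := hodd p.2 hp (u p.1 - u (p.1 - p.2))
    simp only [hF, hG, sub_neg_eq_add, sub_add_cancel]
    rw [← inner_neg_left, ← this, neg_sub]
  have hGi : Integrable G μ := by
    have h4 : Integrable (fun p => F (p.1 - p.2, -p.2)) μ := (hS.integrable_comp_emb hSe).2 h₂
    simpa using (h4.congr hFS).neg
  have hGF : ∫ p, G p ∂μ = -∫ p, F p ∂μ := by
    have h5 : ∫ p, F (p.1 - p.2, -p.2) ∂μ = ∫ p, F p ∂μ := hS.integral_comp hSe F
    rw [← h5, integral_congr_ae hFS, integral_neg, neg_neg]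
  have hl : ∫ x, inner ℝ (peridynamicOp δ f u x) (v x) = -∫ p, F p ∂μ := by
    rw [integral_prod _ h₂, ← integral_neg]
    refine integral_congr_ae ?_
    filter_upwards [h₁] with x hx
    rw [hK x, inner_neg_left, real_inner_comm, ← integral_inner hx]
    simp only [hF, real_inner_comm]
  have hr : (∫ x : Space N, ∫ y in B, inner ℝ (f y (u x - u (x - y))) (v x - v (x - y)))
      = ∫ p, (F p - G p) ∂μ := by
    have h6 := integral_prod _ (h₂.sub hGi)
    simp only [Pi.sub_apply] at h6
    rw [h6]
    simp only [hF, hG, inner_sub_right]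
  rw [hl, pairingK, hr, integral_sub h₂ hGi, hGF]
  ring

/-- `u` (with `u t x` the value at time `t`, position `x`) is a weak solution of
`∂_tt u = Ku`, `u(·, 0) = u₀`, `∂_t u(·, 0) = v₀`. -/
structure IsWeakSolution {N : ℕ} (δ α : ℝ) (f : Space N → Space N → Space N)
    (u₀ v₀ : Space N → Space N) (u : ℝ → Space N → Space N) : Prop where
  memX : MemX δ α u
  equation : ∀ φ : ℝ → Space N → Space N, IsTestFunction φ →
    (∫ t in Ioi (0 : ℝ),
        ((∫ x, inner ℝ (u t x) (iteratedDeriv 2 (fun s => φ s x) t)) - pairingK δ f (u t) (φ t)))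
      - (∫ x, inner ℝ (v₀ x) (φ 0 x))
      + (∫ x, inner ℝ (u₀ x) (deriv (fun s => φ s x) 0)) = 0

/-- `U : [0, ∞) → L²(ℝ^N; ℝ^N)` is the continuous representative of `u`. -/
structure IsContinuousRep {N : ℕ} (u : ℝ → Space N → Space N)
    (U : ℝ → Lp (Space N) 2 (volume : Measure (Space N))) : Prop where
  continuousOn : ContinuousOn U (Ici 0)
  ae_eq : ∀ᵐ t ∂volume.restrict (Ioi (0 : ℝ)), U t =ᵐ[volume] u t

/-- `λ = ∫_{B_δ(0)} g(y)² |y|^(N + 2α) dy`. -/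
def growthRate {N : ℕ} (δ α : ℝ) (g : Space N → ℝ) : ℝ :=
  ∫ y in Metric.ball (0 : Space N) δ, g y ^ 2 * ‖y‖ ^ ((N : ℝ) + 2 * α)

end Peridynamics

end

/-! Let D_y w = w - w(· - y), and let G w = (y ↦ D_y w) be the closed operator from L² into
L²(|y|^{-(N+2α)} dy on B_δ; L²), so that ‖G w‖ = [w]. The singular linear part of the force
contributes -κ G*G to the equation. The remaining part is ∇_uΨ, which by the Hessian bound is
Lipschitz in u with constant g(y). Since ‖D_y h‖ ≤ 2‖h‖ and g is integrable on B_δ, it acts as a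
Lipschitz map P of L² (`IsPerturbation.exists_operator`). The problem is therefore the semilinear
wave equation c'' + κ G*G c = P(c).

Let w be the difference of two solutions c and d. Formally, multiplication by w' gives d/dt (‖w'‖² +
κ[w]²) = 2⟨P c - P d, w'⟩. Cauchy–Schwarz with the weights |y|^{±(N+2α)/2} yields ‖P c - P d‖² ≤
λ[w]² (`weightedDiff_sq_le`). The right side is then at most λ‖w'‖² + [w]² ≤ (λ + 1/κ)(‖w'‖² +
κ[w]²), and Gronwall gives the estimate. For equal data the velocities coincide, and integration in
time gives uniqueness.

The difficulty is that w' is only in L² in space and is not an admissible test function. Spatial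
mollifiers R_n are self-adjoint contractions commuting with D_y, and T_n = G R_n is bounded:
mollification makes D_y of order |y|, and α < 1. Testing with R_n² k turns the weak equation into an
ODE in L² with bounded operators (`IsWeakSolution.isMollifiedSolution`,
`IsWeakSecondDeriv.eq_primitive`). Its energy identity, polarised between two mollification indices
(`energy_bilin`), shows that mollified velocities and nonlocal gradients are Cauchy. In the limit
there is a continuous velocity and an exact energy equality (`exists_energy_eq`). That result
concerns a linear equation with given source, so it applies to the difference of two solutions as
well (`IsMollifier.exists_stability`). -/

noncomputable section

set_option linter.unusedSectionVars false

namespace Peridynamics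

/-! ### Lipschitz primitives and weak second derivatives of vector-valued curves -/

section Calculus

open Filter Topology

variable {E F G : Type*} [NormedAddCommGroup E] [NormedSpace ℝ E] [NormedAddCommGroup F]
  [NormedSpace ℝ F] [NormedAddCommGroup G] [NormedSpace ℝ G]

/-- Measurable functions of time that are essentially bounded on bounded intervals. -/
structure LocBounded (r : ℝ → E) : Prop where
  aesm : AEStronglyMeasurable r volume
  bdd : ∀ T : ℝ, ∃ C : ℝ, 0 ≤ C ∧ ∀ᵐ s, |s| ≤ T → ‖r s‖ ≤ C

theorem LocBounded.clm {r : ℝ → E} (h : LocBounded r) (L : E →L[ℝ] F) :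
    LocBounded (fun t => L (r t)) where
  aesm := L.continuous.comp_aestronglyMeasurable h.aesm
  bdd T := by
    obtain ⟨C, hC0, hC⟩ := h.bdd T
    refine ⟨‖L‖ * C, by positivity, ?_⟩
    filter_upwards [hC] with s hs hsT
    exact (L.le_opNorm _).trans (by gcongr; exact hs hsT)

theorem LocBounded.bilin {x : ℝ → E} {y : ℝ → F} (hx : LocBounded x) (hy : LocBounded y)
    (B : E →L[ℝ] F →L[ℝ] G) : LocBounded (fun t => B (x t) (y t)) where
  aesm := B.aestronglyMeasurable_comp₂ hx.aesm hy.aesm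
  bdd T := by
    obtain ⟨C, hC0, hC⟩ := hx.bdd T
    obtain ⟨D, hD0, hD⟩ := hy.bdd T
    refine ⟨‖B‖ * C * D, by positivity, ?_⟩
    filter_upwards [hC, hD] with s hs hs' hsT
    exact (B.le_opNorm₂ _ _).trans (by gcongr; exacts [hs hsT, hs' hsT])

theorem LocBounded.add {x y : ℝ → E} (hx : LocBounded x) (hy : LocBounded y) :
    LocBounded (fun t => x t + y t) where
  aesm := hx.aesm.add hy.aesm
  bdd T := by
    obtain ⟨C, hC0, hC⟩ := hx.bdd T
    obtain ⟨D, hD0, hD⟩ := hy.bdd T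
    refine ⟨C + D, by positivity, ?_⟩
    filter_upwards [hC, hD] with s hs hs' hsT
    exact (norm_add_le _ _).trans (add_le_add (hs hsT) (hs' hsT))

theorem LocBounded.const_smul {x : ℝ → E} (hx : LocBounded x) (a : ℝ) :
    LocBounded (fun t => a • x t) :=
  hx.clm (a • ContinuousLinearMap.id ℝ E)

theorem LocBounded.sub {x y : ℝ → E} (hx : LocBounded x) (hy : LocBounded y) :
    LocBounded (fun t => x t - y t) := by
  simpa [sub_eq_add_neg] using hx.add (hy.const_smul (-1))

theorem LocBounded.of_continuous {x : ℝ → E} (hx : Continuous x) : LocBounded x where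
  aesm := hx.aestronglyMeasurable
  bdd T := by
    obtain ⟨C, hC⟩ := (isCompact_Icc (a := -T) (b := T)).exists_bound_of_continuousOn
      hx.continuousOn
    exact ⟨max C 0, le_max_right _ _,
      .of_forall fun s hs => (hC s (abs_le.1 hs)).trans (le_max_left _ _)⟩

theorem LocBounded.locallyIntegrable {r : ℝ → E} (h : LocBounded r) :
    LocallyIntegrable r volume := by
  rw [locallyIntegrable_iff]
  intro k hk
  obtain ⟨T, hT⟩ := hk.isBounded.exists_norm_le
  obtain ⟨C, -, hC⟩ := h.bdd T
  refine Measure.integrableOn_of_bounded (M := C) hk.measure_lt_top.ne h.aesm ?_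
  filter_upwards [ae_restrict_of_ae hC, ae_restrict_mem hk.measurableSet] with s hs hsk
  exact hs (hT s hsk)

theorem LocBounded.intervalIntegrable {r : ℝ → E} (h : LocBounded r) (a b : ℝ) :
    IntervalIntegrable r volume a b :=
  intervalIntegrable_iff.2
    ((h.locallyIntegrable.integrableOn_isCompact isCompact_uIcc).mono_set uIoc_subset_uIcc)

/-- `X` is a locally Lipschitz primitive of the locally bounded function `x`. -/
structure IsPrimitive (X x : ℝ → E) : Prop where
  locBounded : LocBounded x
  eq : ∀ t, X t = X 0 + ∫ s in (0 : ℝ)..t, x s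

theorem IsPrimitive.sub_eq {X x : ℝ → E} (h : IsPrimitive X x) (s t : ℝ) :
    X t - X s = ∫ r in s..t, x r := by
  rw [h.eq t, h.eq s, add_sub_add_left_eq_sub,
    intervalIntegral.integral_interval_sub_left] <;> exact h.locBounded.intervalIntegrable _ _

theorem IsPrimitive.lipschitz {X x : ℝ → E} (h : IsPrimitive X x) (T : ℝ) :
    ∃ C : ℝ, 0 ≤ C ∧ ∀ s t, |s| ≤ T → |t| ≤ T → ‖X t - X s‖ ≤ C * |t - s| := by
  obtain ⟨C, hC0, hC⟩ := h.locBounded.bdd T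
  refine ⟨C, hC0, fun s t hs ht => ?_⟩
  rw [h.sub_eq s t]
  refine intervalIntegral.norm_integral_le_of_norm_le_const_ae ?_
  filter_upwards [hC] with r hr hrI
  apply hr
  rw [abs_le] at *
  rcases le_total s t with h | h
  · rw [uIoc_of_le h] at hrI; constructor <;> linarith [hrI.1, hrI.2]
  · rw [uIoc_of_ge h] at hrI; constructor <;> linarith [hrI.1, hrI.2]

theorem IsPrimitive.continuous {X x : ℝ → E} (h : IsPrimitive X x) : Continuous X := by
  have : X = fun t => X 0 + ∫ s in (0 : ℝ)..t, x s := funext h.eq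
  rw [this]
  exact continuous_const.add
    (intervalIntegral.continuous_primitive h.locBounded.intervalIntegrable _)

theorem IsPrimitive.ae_hasDerivAt [CompleteSpace E] {X x : ℝ → E} (h : IsPrimitive X x) :
    ∀ᵐ t, HasDerivAt X (x t) t := by
  have : X = fun t => X 0 + ∫ s in (0 : ℝ)..t, x s := funext h.eq
  filter_upwards [LocallyIntegrable.ae_hasDerivAt_integral h.locBounded.locallyIntegrable] with t ht
  rw [this]
  exact (ht 0).const_add _

theorem IsPrimitive.of_integral {x : ℝ → E} (h : LocBounded x) (a : E) :
    IsPrimitive (fun t => a + ∫ s in (0 : ℝ)..t, x s) x :=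
  ⟨h, fun t => by simp⟩

/-- Locally Lipschitz functions are primitives of their almost everywhere derivative. -/
theorem IsPrimitive.of_lipschitz [CompleteSpace E] {X x : ℝ → E} (hx : LocBounded x)
    (hL : ∀ T : ℝ, ∃ C : ℝ, 0 ≤ C ∧ ∀ s t, |s| ≤ T → |t| ≤ T → ‖X t - X s‖ ≤ C * |t - s|)
    (hd : ∀ᵐ t, HasDerivAt X (x t) t) : IsPrimitive X x := by
  refine ⟨hx, fun t => ?_⟩
  -- `Z` is absolutely continuous with derivative zero almost everywhere, hence constant.
  set Z := fun t => X t - (X 0 + ∫ s in (0 : ℝ)..t, x s) with hZ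
  have hp := IsPrimitive.of_integral hx (X 0)
  obtain ⟨C, hC0, hC⟩ := hL |t|
  obtain ⟨D, hD0, hD⟩ := hp.lipschitz |t|
  have hI : ∀ s ∈ uIcc 0 t, |s| ≤ |t| := by
    intro s hs
    rw [mem_uIcc] at hs
    rcases hs with hs | hs
    · rw [abs_of_nonneg hs.1, abs_of_nonneg (hs.1.trans hs.2)]; exact hs.2
    · rw [abs_of_nonpos hs.2, abs_of_nonpos (hs.1.trans hs.2)]; linarith [hs.1]
  have hac : AbsolutelyContinuousOnInterval Z 0 t := by
    refine LipschitzOnWith.absolutelyContinuousOnInterval (K := ⟨C + D, by positivity⟩) ?_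
    refine LipschitzOnWith.of_dist_le_mul fun a ha b hb => ?_
    rw [dist_eq_norm, Real.dist_eq]
    have e : Z a - Z b = (X a - X b)
      - ((X 0 + ∫ s in (0 : ℝ)..a, x s) - (X 0 + ∫ s in (0 : ℝ)..b, x s)) := by
      simp only [hZ]; abel
    rw [e]
    refine (norm_sub_le _ _).trans ?_
    change _ ≤ (C + D) * |a - b|
    rw [add_mul]
    exact add_le_add (hC _ _ (hI b hb) (hI a ha)) (hD _ _ (hI b hb) (hI a ha))
  obtain ⟨c, hc⟩ := hac.const_of_ae_hasDerivAt_zero (by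
    filter_upwards [hd, hp.ae_hasDerivAt] with s h1 h2 _
    have := h1.sub h2
    rwa [sub_self] at this)
  have h0 := hc 0 left_mem_uIcc
  have h1 := hc t right_mem_uIcc
  simp only [hZ] at h0 h1
  rw [← h0] at h1
  simpa [sub_eq_zero] using h1

theorem IsPrimitive.bilin [CompleteSpace E] [CompleteSpace F] [CompleteSpace G]
    {X x : ℝ → E} {Y y : ℝ → F}
    (hX : IsPrimitive X x) (hY : IsPrimitive Y y) (B : E →L[ℝ] F →L[ℝ] G) :
    IsPrimitive (fun t => B (X t) (Y t)) (fun t => B (X t) (y t) + B (x t) (Y t)) := by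
  refine .of_lipschitz ?_ (fun T => ?_) ?_
  · exact ((LocBounded.of_continuous hX.continuous).bilin hY.locBounded B).add
      (hX.locBounded.bilin (.of_continuous hY.continuous) B)
  · obtain ⟨C, hC0, hC⟩ := hX.lipschitz T
    obtain ⟨D, hD0, hD⟩ := hY.lipschitz T
    obtain ⟨M, hM0, hM⟩ : ∃ M : ℝ, 0 ≤ M ∧ ∀ s, |s| ≤ T → ‖X s‖ ≤ M := by
      obtain ⟨M, hM⟩ := (isCompact_Icc (a := -T) (b := T)).exists_bound_of_continuousOn
        hX.continuous.continuousOn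
      exact ⟨max M 0, le_max_right _ _, fun s hs => (hM s (abs_le.1 hs)).trans (le_max_left _ _)⟩
    obtain ⟨M', hM0', hM'⟩ : ∃ M : ℝ, 0 ≤ M ∧ ∀ s, |s| ≤ T → ‖Y s‖ ≤ M := by
      obtain ⟨M, hM⟩ := (isCompact_Icc (a := -T) (b := T)).exists_bound_of_continuousOn
        hY.continuous.continuousOn
      exact ⟨max M 0, le_max_right _ _, fun s hs => (hM s (abs_le.1 hs)).trans (le_max_left _ _)⟩
    refine ⟨‖B‖ * (M * D + C * M'), by positivity, fun s t hs ht => ?_⟩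
    have e : B (X t) (Y t) - B (X s) (Y s) = B (X t) (Y t - Y s) + B (X t - X s) (Y s) := by
      simp
    rw [e]
    calc _ ≤ ‖B‖ * ‖X t‖ * ‖Y t - Y s‖ + ‖B‖ * ‖X t - X s‖ * ‖Y s‖ :=
          (norm_add_le _ _).trans (add_le_add (B.le_opNorm₂ _ _) (B.le_opNorm₂ _ _))
      _ ≤ ‖B‖ * M * (D * |t - s|) + ‖B‖ * (C * |t - s|) * M' := by
          gcongr
          exacts [hM t ht, hD s t hs ht, hC s t hs ht, hM' s hs]
      _ = _ := by ring
  · filter_upwards [hX.ae_hasDerivAt, hY.ae_hasDerivAt] with t h1 h2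
    exact B.hasDerivAt_of_bilinear (fun _ => h1) (fun _ => h2)

theorem IsPrimitive.clm [CompleteSpace E] [CompleteSpace F] {X x : ℝ → E} (h : IsPrimitive X x)
    (L : E →L[ℝ] F) : IsPrimitive (fun t => L (X t)) (fun t => L (x t)) :=
  ⟨h.locBounded.clm L, fun t => by
    rw [h.eq t, map_add, L.intervalIntegral_comp_comm (h.locBounded.intervalIntegrable _ _)]⟩

theorem IsPrimitive.of_hasDerivAt [CompleteSpace E] {X x : ℝ → E} (hx : Continuous x)
    (h : ∀ t, HasDerivAt X (x t) t) : IsPrimitive X x :=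
  ⟨.of_continuous hx, fun t => by
    rw [intervalIntegral.integral_eq_sub_of_hasDerivAt (fun s _ => h s)
      (hx.intervalIntegrable _ _)]; abel⟩

/-- Every smooth function agrees near the half line with the second derivative of a
compactly supported smooth function. -/
theorem exists_iteratedDeriv_two_eq {ψ : ℝ → ℝ} (hψ : ContDiff ℝ (⊤ : ℕ∞) ψ)
    (hc : HasCompactSupport ψ) :
    ∃ η : ℝ → ℝ, ContDiff ℝ (⊤ : ℕ∞) η ∧ HasCompactSupport η ∧
      ∀ t, 0 < t → iteratedDeriv 2 η t = ψ t := by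
  obtain ⟨M, hM⟩ := hc.isCompact.isBounded.exists_norm_le
  have hM' : ∀ t, M < t → ψ t = 0 := fun t ht => by
    by_contra h
    have := hM t (subset_tsupport _ h)
    rw [Real.norm_eq_abs] at this
    linarith [le_abs_self t]
  -- Integrating from `M + 1`, to the right of the support, keeps every primitive zero beyond `M`.
  have prim : ∀ f : ℝ → ℝ, ContDiff ℝ (⊤ : ℕ∞) f → (∀ t, M < t → f t = 0) →
      ∃ F : ℝ → ℝ, ContDiff ℝ (⊤ : ℕ∞) F ∧ (∀ t, M < t → F t = 0) ∧
        ∀ t, HasDerivAt F (f t) t := by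
    intro f hf h0
    have hd : ∀ t, HasDerivAt (fun t => ∫ s in (M + 1)..t, f s) (f t) t := fun t =>
      (hf.continuous.integral_hasStrictDerivAt _ t).hasDerivAt
    refine ⟨fun t => ∫ s in (M + 1)..t, f s, ?_, fun t ht => ?_, hd⟩
    · rw [contDiff_infty_iff_deriv]
      refine ⟨fun t => (hd t).differentiableAt, ?_⟩
      have : deriv (fun t => ∫ s in (M + 1)..t, f s) = f := funext fun t => (hd t).deriv
      rwa [this]
    · refine (intervalIntegral.integral_congr (g := fun _ => (0 : ℝ)) fun s hs => ?_).trans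
        (by simp)
      apply h0
      rw [mem_uIcc] at hs
      rcases hs with hs | hs <;> linarith [hs.1]
  obtain ⟨F, hF, hF0, hFd⟩ := prim ψ hψ hM'
  obtain ⟨F₂, hF2, hF20, hFd2⟩ := prim F hF hF0
  -- The cutoff is 0 for t ≤ -2 and 1 for t ≥ -1, so it makes the support compact without changing
  -- anything near the half line.
  refine ⟨fun t => Real.smoothTransition (t + 2) * F₂ t, ?_, ?_, fun t ht => ?_⟩
  · exact (Real.smoothTransition.contDiff.comp (contDiff_id.add contDiff_const)).mul hF2
  · refine HasCompactSupport.of_support_subset_isCompact (isCompact_Icc (a := -2) (b := M)) ?_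
    intro t ht
    by_contra h
    apply ht
    rw [mem_Icc, not_and_or] at h
    rcases h with h | h
    · simp [Real.smoothTransition.zero_of_nonpos (x := t + 2) (by linarith)]
    · simp [hF20 t (by linarith)]
  · have e : ∀ t, -1 < t → (fun t => Real.smoothTransition (t + 2) * F₂ t) =ᶠ[𝓝 t] F₂ :=
      fun t ht => by
        filter_upwards [lt_mem_nhds ht] with s hs
        simp [Real.smoothTransition.one_of_one_le (x := s + 2) (by linarith)]
    rw [(e t (by linarith)).iteratedDeriv_eq 2, iteratedDeriv_succ, iteratedDeriv_one]
    have : deriv F₂ = F := funext fun t => (hFd2 t).deriv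
    rw [this, (hFd t).deriv]

/-- Integration over the half line of a compactly supported primitive. -/
theorem IsPrimitive.integral_Ioi [CompleteSpace E] {X x : ℝ → E} (h : IsPrimitive X x) {M : ℝ}
    (hM : 0 ≤ M) (hX : X M = 0) (hx : ∀ t, M < t → x t = 0) : ∫ t in Ioi (0 : ℝ), x t = -X 0 := by
  have h1 := h.eq M
  rw [hX, intervalIntegral.integral_of_le hM] at h1
  rw [setIntegral_eq_of_subset_of_forall_sdiff_eq_zero (s := Ioc 0 M) measurableSet_Ioi
    Ioc_subset_Ioi_self (fun t ht => hx t (not_le.1 fun h => ht.2 ⟨ht.1, h⟩))]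
  exact (neg_eq_of_add_eq_zero_right h1.symm).symm

/-- The weak form of `c'' = r`, `c(0) = b₀`, `c'(0) = b₁` on the half line. -/
def IsWeakSecondDeriv (c r : ℝ → E) (b₀ b₁ : E) : Prop :=
  ∀ η : ℝ → ℝ, ContDiff ℝ (⊤ : ℕ∞) η → HasCompactSupport η →
    ∫ t in Ioi (0 : ℝ), (iteratedDeriv 2 η t • c t - η t • r t) = η 0 • b₁ - deriv η 0 • b₀

theorem LocBounded.integrable_weak {c r : ℝ → E} (hc : LocBounded c) (hr : LocBounded r)
    {η : ℝ → ℝ} (hη : ContDiff ℝ (⊤ : ℕ∞) η) (hηc : HasCompactSupport η) :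
    Integrable fun t => iteratedDeriv 2 η t • c t - η t • r t := by
  have h2 : HasCompactSupport (iteratedDeriv 2 η) := by
    rw [iteratedDeriv_eq_iterate]
    exact hηc.deriv.deriv
  exact (hc.locallyIntegrable.integrable_smul_left_of_hasCompactSupport
    (hη.continuous_iteratedDeriv 2 ENat.LEInfty.out) h2).sub
    (hr.locallyIntegrable.integrable_smul_left_of_hasCompactSupport hη.continuous hηc)

/-- Two integrations by parts in one: η' P - η Q is a primitive of η'' P - η r and vanishes for
large times, so only its value at 0 remains. Primitives replace classical derivatives because r is
merely locally bounded. -/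
theorem IsPrimitive.isWeakSecondDeriv [CompleteSpace E] {P Q r : ℝ → E} (hP : IsPrimitive P Q)
    (hQ : IsPrimitive Q r) : IsWeakSecondDeriv P r (P 0) (Q 0) := by
  intro η hη hc
  have hη1 : ContDiff ℝ (⊤ : ℕ∞) (deriv η) := (contDiff_infty_iff_deriv.1 hη).2
  have hd : ∀ t, HasDerivAt η (deriv η t) t := fun t =>
    (hη.differentiable (by simp) t).hasDerivAt
  have hd1 : ∀ t, HasDerivAt (deriv η) (iteratedDeriv 2 η t) t := fun t => by
    rw [iteratedDeriv_succ, iteratedDeriv_one]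
    exact (hη1.differentiable (by simp) t).hasDerivAt
  have hη2 : Continuous (iteratedDeriv 2 η) := hη.continuous_iteratedDeriv 2 ENat.LEInfty.out
  have i0 := IsPrimitive.of_hasDerivAt hη1.continuous hd
  have i1 := IsPrimitive.of_hasDerivAt hη2 hd1
  have hp : IsPrimitive (fun t => deriv η t • P t - η t • Q t)
      (fun t => iteratedDeriv 2 η t • P t - η t • r t) := by
    have h1 := i1.bilin hP (ContinuousLinearMap.lsmul ℝ ℝ)
    have h2 := i0.bilin hQ (ContinuousLinearMap.lsmul ℝ ℝ)
    simp only [ContinuousLinearMap.lsmul_apply] at h1 h2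
    have e : ∀ t, iteratedDeriv 2 η t • P t - η t • r t
        = (deriv η t • Q t + iteratedDeriv 2 η t • P t) - (η t • r t + deriv η t • Q t) :=
      fun t => by abel
    refine ⟨?_, fun t => ?_⟩
    · simp only [e]; exact h1.locBounded.sub h2.locBounded
    · simp only [e]
      rw [intervalIntegral.integral_sub (h1.locBounded.intervalIntegrable _ _)
        (h2.locBounded.intervalIntegrable _ _), h1.eq t, h2.eq t]
      abel
  obtain ⟨M, hM⟩ := hc.isCompact.isBounded.exists_norm_le
  have hz : ∀ t, |M| < t → η =ᶠ[𝓝 t] 0 := fun t ht => by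
    rw [← notMem_tsupport_iff_eventuallyEq]
    intro h
    have := hM t h
    rw [Real.norm_eq_abs] at this
    linarith [le_abs_self t, le_abs_self M]
  have hzt : ∀ t, |M| < t → η t = 0 ∧ deriv η t = 0 ∧ iteratedDeriv 2 η t = 0 := fun t ht => by
    refine ⟨(hz t ht).eq_of_nhds, ?_, ?_⟩
    · rw [(hz t ht).deriv_eq]; simp
    · rw [(hz t ht).iteratedDeriv_eq 2]; simp
  have h := hp.integral_Ioi (M := |M| + 1) (by positivity)
    (by simp [hzt (|M| + 1) (by linarith)])
    (fun t ht => by simp [hzt t (by linarith)])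
  rw [h]
  abel

/-- The curve c and the double primitive satisfy the same weak identity, so in the difference both r
and the boundary terms cancel. Every test function on (0, ∞) agrees there with some admissible η'',
so the fundamental lemma of the calculus of variations applies. -/
theorem IsWeakSecondDeriv.eq_primitive [CompleteSpace E] {c r : ℝ → E} {b₀ b₁ : E}
    (hc : LocBounded c) (hr : LocBounded r) (h : IsWeakSecondDeriv c r b₀ b₁) :
    ∀ᵐ t, 0 < t → c t = b₀ + ∫ s in (0 : ℝ)..t, (b₁ + ∫ s' in (0 : ℝ)..s, r s') := by
  have hQ := IsPrimitive.of_integral hr b₁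
  have hP := IsPrimitive.of_integral (.of_continuous hQ.continuous) b₀
  have hw := hP.isWeakSecondDeriv hQ
  set P := fun t => b₀ + ∫ s in (0 : ℝ)..t, (b₁ + ∫ s' in (0 : ℝ)..s, r s') with hPdef
  have hli : LocallyIntegrableOn (fun t => c t - P t) (Ioi 0) volume :=
    (hc.sub (.of_continuous hP.continuous)).locallyIntegrable.locallyIntegrableOn _
  have := isOpen_Ioi.ae_eq_zero_of_integral_contDiff_smul_eq_zero hli (fun ψ hψ hψc hψs => ?_)
  · filter_upwards [this] with t ht h0
    exact sub_eq_zero.1 (ht h0)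
  · obtain ⟨η, hη, hηc, hηψ⟩ := exists_iteratedDeriv_two_eq hψ hψc
    have e1 : ∫ t, ψ t • (c t - P t) = ∫ t in Ioi (0 : ℝ), ψ t • (c t - P t) := by
      refine (setIntegral_eq_integral_of_forall_compl_eq_zero fun t ht => ?_).symm
      rw [image_eq_zero_of_notMem_tsupport fun h' => ht (hψs h'), zero_smul]
    have e2 : ∫ t in Ioi (0 : ℝ), ψ t • (c t - P t)
        = ∫ t in Ioi (0 : ℝ), ((iteratedDeriv 2 η t • c t - η t • r t)
          - (iteratedDeriv 2 η t • P t - η t • r t)) := by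
      refine setIntegral_congr_fun measurableSet_Ioi fun t ht => ?_
      simp only [hηψ t ht, smul_sub]
      abel
    rw [e1, e2, integral_sub (hc.integrable_weak hr hη hηc).integrableOn
      (LocBounded.integrable_weak (.of_continuous hP.continuous) hr hη hηc).integrableOn,
      h η hη hηc, hw η hη hηc]
    simp

end Calculus

/-! ### The abstract linear wave equation with source, solved through mollification -/

section LinearWave

open Filter Topology
open scoped RealInnerProductSpace

variable {H K : Type*} [NormedAddCommGroup H] [InnerProductSpace ℝ H] [CompleteSpace H]
  [NormedAddCommGroup K] [InnerProductSpace ℝ K] [CompleteSpace K]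

/-- The real inner product as a continuous bilinear map. -/
def innerL (E : Type*) [NormedAddCommGroup E] [InnerProductSpace ℝ E] : E →L[ℝ] E →L[ℝ] ℝ :=
  LinearMap.mkContinuous₂ (innerₗ E) 1 fun x y => by
    simpa using norm_inner_le_norm (𝕜 := ℝ) x y

@[simp]
theorem innerL_apply {E : Type*} [NormedAddCommGroup E] [InnerProductSpace ℝ E] (x y : E) :
    innerL E x y = ⟪x, y⟫ := rfl

theorem norm_sub_sq_le_two_mul {E : Type*} [NormedAddCommGroup E] (x y z : E) :
    ‖x - y‖ ^ 2 ≤ 2 * ‖x - z‖ ^ 2 + 2 * ‖y - z‖ ^ 2 := by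
  have h1 := norm_sub_le_norm_sub_add_norm_sub x z y
  rw [norm_sub_rev z y] at h1
  nlinarith [norm_nonneg (x - y), sq_nonneg (‖x - z‖ - ‖y - z‖)]

/-- A uniform bound upgrades strong convergence to convergence along moving arguments, which is what
iterated mollification needs. -/
theorem tendsto_apply_of_norm_le {R : ℕ → H →L[ℝ] H} (hR : ∀ n w, ‖R n w‖ ≤ ‖w‖) {w : H}
    (hw : Tendsto (fun n => R n w) atTop (𝓝 w)) {v : ℕ → H} (hv : Tendsto v atTop (𝓝 w)) :
    Tendsto (fun n => R n (v n)) atTop (𝓝 w) := by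
  have h0 : Tendsto (fun n => R n (v n - w)) atTop (𝓝 0) :=
    squeeze_zero_norm (fun n => hR n _) (by simpa using (hv.sub_const w).norm)
  simpa using h0.add hw

/-- A sequence of mollifiers `R n` on `H` adapted to a closed operator with graph `G` from `H`
to `K`; the composition of the closed operator with `R n` is the bounded operator `T n`. -/
structure IsMollifier (R : ℕ → H →L[ℝ] H) (T : ℕ → H →L[ℝ] K) (G : H → K → Prop) : Prop where
  norm_le : ∀ n w, ‖R n w‖ ≤ ‖w‖
  tendsto : ∀ w, Tendsto (fun n => R n w) atTop (𝓝 w)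
  symm : ∀ n w v, ⟪R n w, v⟫ = ⟪w, R n v⟫
  form : ∀ i j w k, ⟪T i w, T i (R i (R j k))⟫ = ⟪T i (R i (R i w)), T j k⟫
  graph : ∀ u k, G u k → Tendsto (fun n => T n (R n (R n u))) atTop (𝓝 k)
  closed : ∀ (w : ℕ → H) u k, Tendsto (fun n => R n (w n)) atTop (𝓝 u) →
    Tendsto (fun n => T n (w n)) atTop (𝓝 k) → G u k

variable {R : ℕ → H →L[ℝ] H} {T : ℕ → H →L[ℝ] K} {G : H → K → Prop}

theorem IsMollifier.tendsto_cube (S : IsMollifier R T G) (w : H) :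
    Tendsto (fun n => R n (R n (R n w))) atTop (𝓝 w) := by
  exact tendsto_apply_of_norm_le S.norm_le (S.tendsto w)
    (tendsto_apply_of_norm_le S.norm_le (S.tendsto w) (S.tendsto w))

theorem IsMollifier.norm_cube_le (S : IsMollifier R T G) (n : ℕ) (w : H) :
    ‖R n (R n (R n w))‖ ≤ ‖w‖ :=
  (S.norm_le _ _).trans ((S.norm_le _ _).trans (S.norm_le _ _))

/-- Weak solutions of `c'' + κ G† G c = F`, `c(0) = u₀`, `c'(0) = v₀`, tested with mollified
elements only. -/
structure IsMollifiedSolution (R : ℕ → H →L[ℝ] H) (T : ℕ → H →L[ℝ] K) (κ : ℝ) (c F : ℝ → H)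
    (u₀ v₀ : H) : Prop where
  locBounded : LocBounded c
  locBounded_source : LocBounded F
  weak : ∀ n, IsWeakSecondDeriv (fun t => R n (R n (c t)))
    (fun t => R n (R n (F t)) - κ • (T n).adjoint (T n (c t))) (R n (R n u₀)) (R n (R n v₀))

/-- The second time derivative of the twice mollified solution. -/
def mollAcc (R : ℕ → H →L[ℝ] H) (T : ℕ → H →L[ℝ] K) (κ : ℝ) (c F : ℝ → H) (n : ℕ) (t : ℝ) : H :=
  R n (R n (F t)) - κ • (T n).adjoint (T n (c t))

/-- The time derivative of the twice mollified solution. -/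
def mollVel (R : ℕ → H →L[ℝ] H) (T : ℕ → H →L[ℝ] K) (κ : ℝ) (c F : ℝ → H) (v₀ : H) (n : ℕ)
    (t : ℝ) : H :=
  R n (R n v₀) + ∫ s in (0 : ℝ)..t, mollAcc R T κ c F n s

/-- The continuous representative of the twice mollified solution. -/
def mollPos (R : ℕ → H →L[ℝ] H) (T : ℕ → H →L[ℝ] K) (κ : ℝ) (c F : ℝ → H) (u₀ v₀ : H) (n : ℕ)
    (t : ℝ) : H :=
  R n (R n u₀) + ∫ s in (0 : ℝ)..t, mollVel R T κ c F v₀ n s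

variable {κ : ℝ} {c F : ℝ → H} {u₀ v₀ : H} {k₀ : K}

namespace IsMollifiedSolution

theorem primitive_vel (h : IsMollifiedSolution R T κ c F u₀ v₀) (n : ℕ) :
    IsPrimitive (mollVel R T κ c F v₀ n) (mollAcc R T κ c F n) :=
  .of_integral (((h.locBounded_source.clm (R n)).clm (R n)).sub
    (((h.locBounded.clm (T n)).clm (T n).adjoint).const_smul κ)) _

theorem primitive_pos (h : IsMollifiedSolution R T κ c F u₀ v₀) (n : ℕ) :
    IsPrimitive (mollPos R T κ c F u₀ v₀ n) (mollVel R T κ c F v₀ n) :=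
  .of_integral (.of_continuous (h.primitive_vel n).continuous) _

theorem ae_eq_pos (h : IsMollifiedSolution R T κ c F u₀ v₀) (n : ℕ) :
    ∀ᵐ t, 0 < t → R n (R n (c t)) = mollPos R T κ c F u₀ v₀ n t :=
  (h.weak n).eq_primitive ((h.locBounded.clm (R n)).clm (R n))
    (h.primitive_vel n).locBounded

/-- With positions p and velocities q, the elastic part of the derivative of ⟪R_n q_n, R_m q_m⟫ is
-κ(⟪T_n p_n, T_m q_m⟫ + ⟪T_n q_n, T_m p_m⟫). It cancels the derivative of κ⟪T_n p_n, T_m p_m⟫,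
leaving only the source. Two different indices are allowed so that the energy of a difference can be
computed. -/
theorem energy_bilin (S : IsMollifier R T G) (h : IsMollifiedSolution R T κ c F u₀ v₀)
    (n m : ℕ) {t : ℝ} (ht : 0 ≤ t) :
    ⟪R n (mollVel R T κ c F v₀ n t), R m (mollVel R T κ c F v₀ m t)⟫
        + κ * ⟪T n (mollPos R T κ c F u₀ v₀ n t), T m (mollPos R T κ c F u₀ v₀ m t)⟫
      = ⟪R n (R n (R n v₀)), R m (R m (R m v₀))⟫
        + κ * ⟪T n (R n (R n u₀)), T m (R m (R m u₀))⟫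
        + ∫ s in (0 : ℝ)..t, (⟪R n (R n (R n (F s))), R m (mollVel R T κ c F v₀ m s)⟫
          + ⟪R n (mollVel R T κ c F v₀ n s), R m (R m (R m (F s)))⟫) := by
  have h1 := ((h.primitive_vel n).clm (R n)).bilin ((h.primitive_vel m).clm (R m)) (innerL H)
  have h2 := ((h.primitive_pos n).clm (T n)).bilin ((h.primitive_pos m).clm (T m)) (innerL K)
  simp only [innerL_apply] at h1 h2
  have e1 := h1.eq t
  have e2 := h2.eq t
  have z1 : ∀ n, mollVel R T κ c F v₀ n 0 = R n (R n v₀) := fun n => by simp [mollVel]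
  have z2 : ∀ n, mollPos R T κ c F u₀ v₀ n 0 = R n (R n u₀) := fun n => by simp [mollPos]
  simp only [z1, z2] at e1 e2
  rw [e1, e2, mul_add, add_add_add_comm]
  congr 1
  have i2 := (h2.locBounded.const_smul κ).intervalIntegrable 0 t
  simp only [smul_eq_mul] at i2
  rw [← intervalIntegral.integral_const_mul, ← intervalIntegral.integral_add
    (h1.locBounded.intervalIntegrable _ _) i2]
  -- The accelerations contain c rather than its continuous representative. The two mollified
  -- versions agree for almost every positive time, which suffices under the integral.
  refine intervalIntegral.integral_congr_ae ?_
  filter_upwards [h.ae_eq_pos n, h.ae_eq_pos m] with s hn hm hs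
  rw [uIoc_of_le ht] at hs
  rw [← hn hs.1, ← hm hs.1]
  set q := mollVel R T κ c F v₀ n s
  set q' := mollVel R T κ c F v₀ m s
  -- Only mollifiers of index `i` change sides here, so mollifiers of different indices are never
  -- required to commute.
  have adj : ∀ i j w k, ⟪R i ((T i).adjoint (T i w)), R j k⟫ = ⟪T i (R i (R i w)), T j k⟫ :=
    fun i j w k => by rw [S.symm, ContinuousLinearMap.adjoint_inner_left, S.form]
  have a1 : ⟪R n (mollAcc R T κ c F n s), R m q'⟫
      = ⟪R n (R n (R n (F s))), R m q'⟫ - κ * ⟪T n (R n (R n (c s))), T m q'⟫ := by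
    rw [mollAcc, map_sub, map_smul, inner_sub_left, real_inner_smul_left, adj]
  have a2 : ⟪R n q, R m (mollAcc R T κ c F m s)⟫
      = ⟪R n q, R m (R m (R m (F s)))⟫ - κ * ⟪T n q, T m (R m (R m (c s)))⟫ := by
    rw [mollAcc, map_sub, map_smul, inner_sub_right, real_inner_smul_right,
      real_inner_comm (R m ((T m).adjoint _)), adj, real_inner_comm (T n q)]
  rw [a1, a2]
  ring

/-- Expanding squares, this is the combination (n,n) - 2(n,m) + (m,m) of `energy_bilin`. -/
theorem energy_sub (S : IsMollifier R T G) (h : IsMollifiedSolution R T κ c F u₀ v₀)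
    (n m : ℕ) {t : ℝ} (ht : 0 ≤ t) :
    ‖R n (mollVel R T κ c F v₀ n t) - R m (mollVel R T κ c F v₀ m t)‖ ^ 2
        + κ * ‖T n (mollPos R T κ c F u₀ v₀ n t) - T m (mollPos R T κ c F u₀ v₀ m t)‖ ^ 2
      = ‖R n (R n (R n v₀)) - R m (R m (R m v₀))‖ ^ 2
        + κ * ‖T n (R n (R n u₀)) - T m (R m (R m u₀))‖ ^ 2
        + 2 * ∫ s in (0 : ℝ)..t, ⟪R n (R n (R n (F s))) - R m (R m (R m (F s))),
          R n (mollVel R T κ c F v₀ n s) - R m (mollVel R T κ c F v₀ m s)⟫ := by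
  have hF : ∀ n, LocBounded fun s => R n (R n (R n (F s))) := fun n =>
    ((h.locBounded_source.clm (R n)).clm (R n)).clm (R n)
  have hv : ∀ n, LocBounded fun s => R n (mollVel R T κ c F v₀ n s) := fun n =>
    .of_continuous ((R n).continuous.comp (h.primitive_vel n).continuous)
  have hi : ∀ i j, IntervalIntegrable
      (fun s => ⟪R i (R i (R i (F s))), R j (mollVel R T κ c F v₀ j s)⟫) volume 0 t := fun i j =>
    ((hF i).bilin (hv j) (innerL H)).intervalIntegrable _ _
  have e : ∀ i j, ∫ s in (0 : ℝ)..t, (⟪R i (R i (R i (F s))), R j (mollVel R T κ c F v₀ j s)⟫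
          + ⟪R i (mollVel R T κ c F v₀ i s), R j (R j (R j (F s)))⟫)
      = (∫ s in (0 : ℝ)..t, ⟪R i (R i (R i (F s))), R j (mollVel R T κ c F v₀ j s)⟫)
        + ∫ s in (0 : ℝ)..t, ⟪R j (R j (R j (F s))), R i (mollVel R T κ c F v₀ i s)⟫ := by
    intro i j
    rw [← intervalIntegral.integral_add (hi i j) (hi j i)]
    simp only [real_inner_comm]
  have e' : ∫ s in (0 : ℝ)..t, ⟪R n (R n (R n (F s))) - R m (R m (R m (F s))),
          R n (mollVel R T κ c F v₀ n s) - R m (mollVel R T κ c F v₀ m s)⟫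
      = ((∫ s in (0 : ℝ)..t, ⟪R n (R n (R n (F s))), R n (mollVel R T κ c F v₀ n s)⟫)
        - ∫ s in (0 : ℝ)..t, ⟪R n (R n (R n (F s))), R m (mollVel R T κ c F v₀ m s)⟫)
        - ((∫ s in (0 : ℝ)..t, ⟪R m (R m (R m (F s))), R n (mollVel R T κ c F v₀ n s)⟫)
        - ∫ s in (0 : ℝ)..t, ⟪R m (R m (R m (F s))), R m (mollVel R T κ c F v₀ m s)⟫) := by
    rw [← intervalIntegral.integral_sub (hi n n) (hi n m),
      ← intervalIntegral.integral_sub (hi m n) (hi m m),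
      ← intervalIntegral.integral_sub ((hi n n).sub (hi n m)) ((hi m n).sub (hi m m))]
    refine intervalIntegral.integral_congr fun s _ => ?_
    simp only [inner_sub_left, inner_sub_right]
    ring
  have nn := energy_bilin S h n n ht
  have nm := energy_bilin S h n m ht
  have mm := energy_bilin S h m m ht
  rw [e] at nn nm mm
  rw [e']
  simp only [real_inner_self_eq_norm_sq] at nn mm
  simp only [norm_sub_sq_real]
  linarith

theorem tendsto_integral_cube_sub (S : IsMollifier R T G) {F : ℝ → H} (hF : LocBounded F)
    (τ : ℝ) : Tendsto (fun n => ∫ s in (0 : ℝ)..τ, ‖R n (R n (R n (F s))) - F s‖) atTop (𝓝 0) := by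
  have hFi := (hF.intervalIntegrable 0 τ).norm.const_mul 2
  have := intervalIntegral.tendsto_integral_filter_of_dominated_convergence (μ := volume)
    (a := 0) (b := τ) (F := fun n s => ‖R n (R n (R n (F s))) - F s‖) (l := atTop)
    (f := fun _ => (0 : ℝ)) (fun s => 2 * ‖F s‖) (.of_forall fun n => ?_)
    (.of_forall fun n => .of_forall fun s _ => ?_) hFi (.of_forall fun s _ => ?_)
  · simpa using this
  · exact (((((hF.clm (R n)).clm (R n)).clm (R n)).sub hF).aesm.norm).restrict
  · rw [norm_norm, two_mul]
    exact (norm_sub_le _ _).trans (by gcongr; exact S.norm_cube_le n _)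
  · simpa using ((S.tendsto_cube (F s)).sub_const (F s)).norm

/-- The source is given, so no Gronwall argument is needed: at a time where the velocity difference
attains its maximum M on [0, τ], the energy identity reads M² ≤ d₀ + 2M(J_n + J_m). This bounds M,
and hence the energy at all times up to τ, by the mollification errors of the data and of the
source. -/
theorem exists_cauchy_bound (S : IsMollifier R T G) (h : IsMollifiedSolution R T κ c F u₀ v₀)
    (hκ : 0 < κ) (hG : G u₀ k₀) {τ : ℝ} (hτ : 0 ≤ τ) :
    ∃ g : ℕ → ℝ, Tendsto g atTop (𝓝 0) ∧ ∀ n m t, 0 ≤ t → t ≤ τ →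
      ‖R n (mollVel R T κ c F v₀ n t) - R m (mollVel R T κ c F v₀ m t)‖ ^ 2
        + κ * ‖T n (mollPos R T κ c F u₀ v₀ n t) - T m (mollPos R T κ c F u₀ v₀ m t)‖ ^ 2
      ≤ g n + g m := by
  set J : ℕ → ℝ := fun n => ∫ s in (0 : ℝ)..τ, ‖R n (R n (R n (F s))) - F s‖ with hJ
  set a : ℕ → ℝ := fun n => ‖R n (R n (R n v₀)) - v₀‖
  set b : ℕ → ℝ := fun n => ‖T n (R n (R n u₀)) - k₀‖
  have hF : ∀ n, LocBounded fun s => R n (R n (R n (F s))) := fun n =>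
    ((h.locBounded_source.clm (R n)).clm (R n)).clm (R n)
  have ha : Tendsto a atTop (𝓝 0) := by
    simpa using ((S.tendsto_cube v₀).sub_const v₀).norm
  have hb : Tendsto b atTop (𝓝 0) := by
    simpa using ((S.graph _ _ hG).sub_const k₀).norm
  -- With J = J_n + J_m, the quadratic inequality gives 2MJ ≤ d₀ + 4J². Together with d₀ ≤ 2(A_n +
  -- A_m), where A = a² + κb², and J² ≤ 2(J_n² + J_m²), the factors 4 and 8 would already do; 6 and
  -- 10 leave slack.
  refine ⟨fun n => 6 * (a n ^ 2 + κ * b n ^ 2) + 10 * J n ^ 2, ?_, fun n m t ht htτ => ?_⟩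
  · have := (((ha.pow 2).add ((hb.pow 2).const_mul κ)).const_mul 6).add
      (((tendsto_integral_cube_sub S h.locBounded_source τ).pow 2).const_mul 10)
    simpa using this
  set X : ℝ → H := fun t => R n (mollVel R T κ c F v₀ n t) - R m (mollVel R T κ c F v₀ m t)
    with hX
  have hXc : Continuous X := ((R n).continuous.comp (h.primitive_vel n).continuous).sub
    ((R m).continuous.comp (h.primitive_vel m).continuous)
  obtain ⟨t₀, ht₀, hmax⟩ := isCompact_Icc.exists_isMaxOn (nonempty_Icc.2 hτ)
    hXc.norm.continuousOn
  set M := ‖X t₀‖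
  set d₀ := ‖R n (R n (R n v₀)) - R m (R m (R m v₀))‖ ^ 2
        + κ * ‖T n (R n (R n u₀)) - T m (R m (R m u₀))‖ ^ 2
  have hd₀ : d₀ ≤ 2 * (a n ^ 2 + κ * b n ^ 2) + 2 * (a m ^ 2 + κ * b m ^ 2) := by
    have h1 := norm_sub_sq_le_two_mul (R n (R n (R n v₀))) (R m (R m (R m v₀))) v₀
    have h2 := norm_sub_sq_le_two_mul (T n (R n (R n u₀))) (T m (R m (R m u₀))) k₀
    have h3 := mul_le_mul_of_nonneg_left h2 hκ.le
    simp only [d₀, a, b]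
    linarith
  have key : ∀ r, 0 ≤ r → r ≤ τ → ‖X r‖ ^ 2
      + κ * ‖T n (mollPos R T κ c F u₀ v₀ n r) - T m (mollPos R T κ c F u₀ v₀ m r)‖ ^ 2
      ≤ d₀ + 2 * (M * (J n + J m)) := by
    intro r hr hrτ
    rw [energy_sub S h n m hr]
    gcongr
    have i1 : ∀ n, IntervalIntegrable (fun s => ‖R n (R n (R n (F s))) - F s‖) volume 0 τ :=
      fun n => (((hF n).sub h.locBounded_source).intervalIntegrable _ _).norm
    have i2 : IntervalIntegrable (fun s => M * (‖R n (R n (R n (F s))) - F s‖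
        + ‖R m (R m (R m (F s))) - F s‖)) volume 0 τ := ((i1 n).add (i1 m)).const_mul M
    have hsub : uIcc 0 r ⊆ uIcc 0 τ := by
      rw [uIcc_of_le hr, uIcc_of_le hτ]; exact Icc_subset_Icc_right hrτ
    calc ∫ s in (0 : ℝ)..r, ⟪R n (R n (R n (F s))) - R m (R m (R m (F s))), X s⟫
        ≤ ∫ s in (0 : ℝ)..r, M * (‖R n (R n (R n (F s))) - F s‖
          + ‖R m (R m (R m (F s))) - F s‖) := by
          refine intervalIntegral.integral_mono_on hr
            (((((hF n).sub (hF m)).bilin (.of_continuous hXc) (innerL H))).intervalIntegrable _ _)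
            (i2.mono_set hsub) fun s hs => ?_
          have h1 := norm_sub_le_norm_sub_add_norm_sub (R n (R n (R n (F s)))) (F s)
            (R m (R m (R m (F s))))
          rw [norm_sub_rev (F s)] at h1
          calc _ ≤ ‖R n (R n (R n (F s))) - R m (R m (R m (F s)))‖ * ‖X s‖ :=
                real_inner_le_norm _ _
            _ ≤ (‖R n (R n (R n (F s))) - F s‖ + ‖R m (R m (R m (F s))) - F s‖) * M := by
                gcongr
                exact hmax ⟨hs.1, hs.2.trans hrτ⟩
            _ = _ := mul_comm _ _
      _ ≤ ∫ s in (0 : ℝ)..τ, M * (‖R n (R n (R n (F s))) - F s‖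
          + ‖R m (R m (R m (F s))) - F s‖) :=
          intervalIntegral.integral_mono_interval le_rfl hr hrτ
            (.of_forall fun s => by positivity) i2
      _ = M * (J n + J m) := by
          rw [intervalIntegral.integral_const_mul, intervalIntegral.integral_add (i1 n) (i1 m)]
  have k0 := key t₀ ht₀.1 ht₀.2
  have k1 := key t ht htτ
  have hM : M ^ 2 ≤ d₀ + 2 * (M * (J n + J m)) := by
    refine le_trans ?_ k0
    have : 0 ≤ κ * ‖T n (mollPos R T κ c F u₀ v₀ n t₀) - T m (mollPos R T κ c F u₀ v₀ m t₀)‖ ^ 2 :=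
      by positivity
    linarith
  refine k1.trans ?_
  nlinarith [sq_nonneg (M - 2 * (J n + J m)), sq_nonneg (J n - J m)]

/-- Well-posedness of the linear wave equation in the energy space: a weak solution has a
continuously differentiable representative which satisfies the energy equality. -/
theorem exists_energy_eq (S : IsMollifier R T G) (h : IsMollifiedSolution R T κ c F u₀ v₀)
    (hκ : 0 < κ) (hG : G u₀ k₀) :
    ∃ (V : ℝ → H) (Y : ℝ → K), Continuous V ∧ V 0 = v₀ ∧
      (∀ᵐ t, 0 < t → c t = u₀ + ∫ s in (0 : ℝ)..t, V s) ∧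
      ∀ t, 0 ≤ t → G (u₀ + ∫ s in (0 : ℝ)..t, V s) (Y t) ∧
        ‖V t‖ ^ 2 + κ * ‖Y t‖ ^ 2
          = ‖v₀‖ ^ 2 + κ * ‖k₀‖ ^ 2 + 2 * ∫ s in (0 : ℝ)..t, ⟪F s, V s⟫ := by
  set X : ℕ → ℝ → H := fun n t => R n (mollVel R T κ c F v₀ n t) with hX
  set Z : ℕ → ℝ → K := fun n t => T n (mollPos R T κ c F u₀ v₀ n t) with hZ
  have hXc : ∀ n, Continuous (X n) := fun n =>
    (R n).continuous.comp (h.primitive_vel n).continuous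
  have hlim : ∀ t, 0 ≤ t → (∃ x, Tendsto (fun n => X n t) atTop (𝓝 x)) ∧
      ∃ y, Tendsto (fun n => Z n t) atTop (𝓝 y) := by
    intro t ht
    obtain ⟨g, hg, hb⟩ := exists_cauchy_bound S h hκ hG ht
    have h2 : Tendsto (fun p : ℕ × ℕ => g p.1 + g p.2) (atTop ×ˢ atTop) (𝓝 0) := by
      simpa using (hg.comp tendsto_fst).add (hg.comp tendsto_snd)
    have hsq : ∀ {f : ℕ × ℕ → ℝ}, (∀ p, 0 ≤ f p) →
        Tendsto (fun p => f p ^ 2) (atTop ×ˢ atTop) (𝓝 0) →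
        Tendsto f (atTop ×ˢ atTop) (𝓝 0) := fun {f} hf h => by
      have := h.sqrt
      simpa [Real.sqrt_sq (hf _)] using this
    constructor
    · refine cauchySeq_tendsto_of_complete ?_
      rw [cauchySeq_iff_tendsto_dist_atTop_0, ← prod_atTop_atTop_eq]
      refine hsq (fun _ => dist_nonneg) (squeeze_zero (fun _ => sq_nonneg _) (fun p => ?_) h2)
      rw [dist_eq_norm]
      have := hb p.1 p.2 t ht le_rfl
      have h0 : 0 ≤ κ * ‖Z p.1 t - Z p.2 t‖ ^ 2 := by positivity
      simp only [hX, hZ] at *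
      linarith
    · refine cauchySeq_tendsto_of_complete ?_
      rw [cauchySeq_iff_tendsto_dist_atTop_0, ← prod_atTop_atTop_eq]
      refine hsq (fun _ => dist_nonneg) (squeeze_zero (fun _ => sq_nonneg _) (fun p => ?_)
        (by simpa using h2.const_mul κ⁻¹))
      rw [dist_eq_norm, ← div_eq_inv_mul, le_div_iff₀' hκ]
      have := hb p.1 p.2 t ht le_rfl
      have h0 : 0 ≤ ‖X p.1 t - X p.2 t‖ ^ 2 := by positivity
      simp only [hX, hZ] at *
      linarith
  choose! V₀ hV₀ using fun t ht => (hlim t ht).1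
  choose! Y hY using fun t ht => (hlim t ht).2
  have hunif : ∀ τ, 0 ≤ τ → TendstoUniformlyOn X V₀ atTop (Icc 0 τ) := by
    intro τ hτ
    obtain ⟨g, hg, hb⟩ := exists_cauchy_bound S h hκ hG hτ
    rw [Metric.tendstoUniformlyOn_iff]
    intro ε hε
    filter_upwards [hg.eventually (gt_mem_nhds (show (0 : ℝ) < ε ^ 2 by positivity))]
      with n hn t ht
    have h1 : ‖X n t - V₀ t‖ ^ 2 ≤ g n + 0 := by
      refine le_of_tendsto_of_tendsto
        ((((hV₀ t ht.1).const_sub (X n t)).norm.pow 2)) (hg.const_add (g n))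
        (.of_forall fun m => ?_)
      have := hb n m t ht.1 ht.2
      have h0 : 0 ≤ κ * ‖Z n t - Z m t‖ ^ 2 := by positivity
      simp only [hX, hZ] at *
      linarith
    rw [dist_comm, dist_eq_norm]
    exact lt_of_pow_lt_pow_left₀ 2 hε.le (by linarith)
  have hV₀c : ContinuousOn V₀ (Ici 0) := by
    intro t ht
    have hc : ContinuousOn V₀ (Icc 0 (t + 1)) :=
      (hunif (t + 1) (by linarith [mem_Ici.1 ht])).continuousOn
      (Frequently.of_forall fun n => (hXc n).continuousOn)
    refine (hc t ⟨ht, by linarith⟩).mono_of_mem_nhdsWithin ?_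
    rw [← Ici_inter_Iic]
    exact inter_mem_nhdsWithin _ (Iic_mem_nhds (by linarith))
  -- The limit `V₀` is controlled for t ≥ 0 only; freezing it at its initial value makes it
  -- continuous on the whole line.
  set V : ℝ → H := fun t => V₀ (max t 0) with hV
  have hVc : Continuous V :=
    hV₀c.comp_continuous (by fun_prop) fun t => mem_Ici.2 (le_max_right _ _)
  have hVV : ∀ t, 0 ≤ t → V t = V₀ t := fun t ht => by simp [hV, ht]
  have hbound : ∀ τ, 0 ≤ τ → ∃ C, ∀ᶠ n in atTop, ∀ s ∈ Icc 0 τ, ‖X n s‖ ≤ C := by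
    intro τ hτ
    obtain ⟨C, hC⟩ := (isCompact_Icc (a := 0) (b := τ)).exists_bound_of_continuousOn
      hVc.continuousOn
    refine ⟨C + 1, ?_⟩
    filter_upwards [Metric.tendstoUniformlyOn_iff.1 (hunif τ hτ) 1 one_pos] with n hn s hs
    have h1 := hn s hs
    have h2 := hC s hs
    rw [hVV s hs.1] at h2
    rw [dist_comm, dist_eq_norm] at h1
    have := norm_le_norm_add_norm_sub' (X n s) (V₀ s)
    linarith
  have hXV : ∀ s, 0 ≤ s → Tendsto (fun n => X n s) atTop (𝓝 (V s)) := fun s hs => by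
    rw [hVV s hs]; exact hV₀ s hs
  have hpos : ∀ t, 0 ≤ t → Tendsto (fun n => R n (mollPos R T κ c F u₀ v₀ n t)) atTop
      (𝓝 (u₀ + ∫ s in (0 : ℝ)..t, V s)) := by
    intro t ht
    obtain ⟨C, hC⟩ := hbound t ht
    have e : ∀ n, R n (mollPos R T κ c F u₀ v₀ n t)
        = R n (R n (R n u₀)) + ∫ s in (0 : ℝ)..t, X n s := fun n => by
      have := ((h.primitive_pos n).clm (R n)).eq t
      simpa [mollPos] using this
    simp only [e]
    refine (S.tendsto_cube u₀).add
      (intervalIntegral.tendsto_integral_filter_of_dominated_convergence (fun _ => C)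
        (.of_forall fun n => (hXc n).aestronglyMeasurable) ?_ (by simp) ?_)
    · filter_upwards [hC] with n hn
      refine .of_forall fun s hs => hn s ?_
      rw [uIoc_of_le ht] at hs
      exact Ioc_subset_Icc_self hs
    · refine .of_forall fun s hs => hXV s ?_
      rw [uIoc_of_le ht] at hs
      exact hs.1.le
  refine ⟨V, Y, hVc, ?_, ?_, fun t ht => ⟨?_, ?_⟩⟩
  · refine tendsto_nhds_unique (hXV 0 le_rfl) ?_
    simpa [hX, mollVel] using S.tendsto_cube v₀
  · filter_upwards [ae_all_iff.2 fun n => h.ae_eq_pos n] with t ht ht0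
    refine tendsto_nhds_unique (S.tendsto_cube (c t)) ?_
    simpa only [ht _ ht0] using hpos t ht0.le
  -- The mollified positions and their gradients both converge, so closedness of the graph
  -- identifies `Y t` as the gradient of the limiting position.
  · exact S.closed _ _ _ (hpos t ht) (hY t ht)
  · obtain ⟨C, hC⟩ := hbound t ht
    obtain ⟨D, hD0, hD⟩ := h.locBounded_source.bdd t
    have hF : ∀ n, LocBounded fun s => R n (R n (R n (F s))) := fun n =>
      ((h.locBounded_source.clm (R n)).clm (R n)).clm (R n)
    have hint : Tendsto (fun n => ∫ s in (0 : ℝ)..t, ⟪R n (R n (R n (F s))), X n s⟫) atTop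
        (𝓝 (∫ s in (0 : ℝ)..t, ⟪F s, V s⟫)) := by
      refine intervalIntegral.tendsto_integral_filter_of_dominated_convergence (fun _ => D * C)
        (.of_forall fun n => (((hF n).bilin (.of_continuous (hXc n)) (innerL H)).aesm).restrict)
        ?_ (by simp) ?_
      · filter_upwards [hC] with n hn
        filter_upwards [hD] with s hs hst
        rw [uIoc_of_le ht] at hst
        refine (norm_inner_le_norm _ _).trans ?_
        gcongr
        · refine (S.norm_cube_le n _).trans (hs ?_)
          rw [abs_of_pos hst.1]
          exact hst.2
        · exact hn s (Ioc_subset_Icc_self hst)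
      · refine .of_forall fun s hs => ?_
        rw [uIoc_of_le ht] at hs
        exact (S.tendsto_cube (F s)).inner (hXV s hs.1.le)
    have l1 : Tendsto (fun n => ‖X n t‖ ^ 2 + κ * ‖Z n t‖ ^ 2) atTop
        (𝓝 (‖V t‖ ^ 2 + κ * ‖Y t‖ ^ 2)) :=
      ((hXV t ht).norm.pow 2).add (((hY t ht).norm.pow 2).const_mul κ)
    have l2 := (((S.tendsto_cube v₀).norm.pow 2).add
      (((S.graph _ _ hG).norm.pow 2).const_mul κ)).add (hint.const_mul 2)
    refine tendsto_nhds_unique l1 (l2.congr fun n => ?_)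
    have := energy_bilin S h n n ht
    simp only [real_inner_self_eq_norm_sq] at this
    rw [this, ← intervalIntegral.integral_const_mul]
    congr 1
    refine intervalIntegral.integral_congr fun s _ => ?_
    simp only [hX, real_inner_comm]
    ring

end IsMollifiedSolution
end LinearWave

/-! ### Translations, differences and mollification on L² -/

section Translations

open Filter Topology
open scoped RealInnerProductSpace

variable {N : ℕ}

/-- The Hilbert space `L²(ℝ^N; ℝ^N)`. -/
abbrev L2 (N : ℕ) : Type := Lp (Space N) 2 (volume : Measure (Space N))

/-- Translation on `L²`. -/
def transl (y : Space N) : L2 N →ₗᵢ[ℝ] L2 N :=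
  Lp.compMeasurePreservingₗᵢ ℝ (fun x => x - y) (measurePreserving_sub_right volume y)

theorem transl_coeFn (y : Space N) (w : L2 N) : transl y w =ᵐ[volume] fun x => w (x - y) :=
  Lp.coeFn_compMeasurePreserving _ (measurePreserving_sub_right volume y)

theorem transl_transl (y z : Space N) (w : L2 N) : transl y (transl z w) = transl (y + z) w := by
  refine Lp.ext ?_
  have h := (measurePreserving_sub_right (volume : Measure (Space N)) y).quasiMeasurePreserving.ae
    (transl_coeFn z w)
  filter_upwards [transl_coeFn y (transl z w), transl_coeFn (y + z) w, h] with x h1 h2 h3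
  rw [h1, h2, h3, sub_sub]

theorem transl_zero (w : L2 N) : transl 0 w = w := by
  refine Lp.ext ?_
  filter_upwards [transl_coeFn 0 w] with x h1
  rw [h1, sub_zero]

theorem inner_transl_left (y : Space N) (w v : L2 N) :
    ⟪transl y w, v⟫ = ⟪w, transl (-y) v⟫ := by
  rw [← LinearIsometry.inner_map_map (transl (-y)) (transl y w), transl_transl, neg_add_cancel,
    transl_zero]

theorem continuous_transl (w : L2 N) : Continuous fun y : Space N => transl y w := by
  let g : C(Space N, C(Space N, Space N)) :=
    ContinuousMap.curry ⟨fun p : Space N × Space N => p.2 - p.1, by fun_prop⟩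
  exact (continuous_const (y := w)).compMeasurePreservingLp g.continuous
    (fun y => measurePreserving_sub_right volume y) (by simp)

/-- The difference operator `w ↦ w - w(· - y)` on `L²`. -/
def diffOp (y : Space N) : L2 N →L[ℝ] L2 N :=
  ContinuousLinearMap.id ℝ _ - (transl y).toContinuousLinearMap

theorem diffOp_apply (y : Space N) (w : L2 N) : diffOp y w = w - transl y w := rfl

theorem diffOp_coeFn (y : Space N) (w : L2 N) :
    diffOp y w =ᵐ[volume] fun x => w x - w (x - y) := by
  filter_upwards [Lp.coeFn_sub w (transl y w), transl_coeFn y w] with x h1 h2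
  rw [diffOp_apply, h1, Pi.sub_apply, h2]

theorem norm_diffOp_le (y : Space N) (w : L2 N) : ‖diffOp y w‖ ≤ 2 * ‖w‖ := by
  rw [diffOp_apply, two_mul]
  exact (norm_sub_le _ _).trans (by rw [LinearIsometry.norm_map])

theorem continuous_diffOp (w : L2 N) : Continuous fun y : Space N => diffOp y w :=
  continuous_const.sub (continuous_transl w)

/-- Mollification on `L²` by a normalized bump function. -/
def mollify (b : ContDiffBump (0 : Space N)) : L2 N →L[ℝ] L2 N :=
  have hi : ∀ w : L2 N, Integrable (fun z => b.normed volume z • transl z w) := fun w =>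
    (b.continuous_normed.smul (continuous_transl w)).integrable_of_hasCompactSupport
      b.hasCompactSupport_normed.smul_right
  LinearMap.mkContinuous
    { toFun := fun w => ∫ z, b.normed volume z • transl z w
      map_add' := fun w v => by
        simp only [map_add, smul_add]
        exact integral_add (hi w) (hi v)
      map_smul' := fun a w => by
        simp only [map_smul, smul_comm _ a, RingHom.id_apply]
        exact integral_smul _ _ } 1 fun w => by
    refine (norm_integral_le_of_norm_le (b.integrable_normed.mul_const ‖w‖)
      (.of_forall fun z => ?_)).trans ?_
    · rw [norm_smul, LinearIsometry.norm_map, Real.norm_of_nonneg (b.nonneg_normed z)]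
    · rw [integral_mul_const, b.integral_normed]

variable (b b' : ContDiffBump (0 : Space N))

theorem mollify_apply (w : L2 N) : mollify b w = ∫ z, b.normed volume z • transl z w := rfl

theorem integrable_mollify (w : L2 N) :
    Integrable (fun z => b.normed volume z • transl z w) :=
  (b.continuous_normed.smul (continuous_transl w)).integrable_of_hasCompactSupport
    b.hasCompactSupport_normed.smul_right

theorem norm_mollify_le (w : L2 N) : ‖mollify b w‖ ≤ ‖w‖ := by
  have h : ‖mollify b‖ ≤ 1 := by
    unfold mollify
    exact LinearMap.mkContinuous_norm_le _ zero_le_one _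
  simpa using (mollify b).le_of_opNorm_le h w

theorem clm_mollify (A : L2 N →L[ℝ] L2 N) (hA : ∀ z w, A (transl z w) = transl z (A w))
    (w : L2 N) : A (mollify b w) = mollify b (A w) := by
  rw [mollify_apply, ← A.integral_comp_comm (integrable_mollify b w), mollify_apply]
  simp only [map_smul, hA]

theorem transl_comm (y z : Space N) (w : L2 N) :
    transl y (transl z w) = transl z (transl y w) := by
  rw [transl_transl, transl_transl, add_comm]

theorem transl_mollify (y : Space N) (w : L2 N) :
    transl y (mollify b w) = mollify b (transl y w) :=
  clm_mollify b (transl y).toContinuousLinearMap (fun z w => transl_comm y z w) w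

theorem diffOp_mollify (y : Space N) (w : L2 N) :
    diffOp y (mollify b w) = mollify b (diffOp y w) := by
  rw [diffOp_apply, diffOp_apply, map_sub, transl_mollify]

theorem inner_mollify_eq_integral (w v : L2 N) :
    ⟪mollify b w, v⟫ = ∫ z, b.normed volume z * ⟪transl z w, v⟫ := by
  rw [real_inner_comm, mollify_apply, ← integral_inner (integrable_mollify b w)]
  simp only [inner_smul_right, real_inner_comm]

/-- The adjoint of a translation is its inverse and the bump is even, so the substitution z ↦ -z
gives the symmetry. -/
theorem inner_mollify_left (w v : L2 N) : ⟪mollify b w, v⟫ = ⟪w, mollify b v⟫ := by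
  rw [inner_mollify_eq_integral, real_inner_comm, inner_mollify_eq_integral,
    ← integral_neg_eq_self]
  refine integral_congr_ae (.of_forall fun z => ?_)
  change b.normed volume (-z) * ⟪transl (-z) w, v⟫ = _
  rw [b.normed_neg, inner_transl_left, neg_neg, real_inner_comm]

theorem tendsto_mollify {ι : Type*} {l : Filter ι} {φ : ι → ContDiffBump (0 : Space N)}
    (hφ : Tendsto (fun i => (φ i).rOut) l (𝓝 0)) (w : L2 N) :
    Tendsto (fun i => mollify (φ i) w) l (𝓝 w) := by
  rw [Metric.tendsto_nhds]
  intro ε hε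
  have hc := (continuous_transl w).tendsto 0
  rw [transl_zero, Metric.tendsto_nhds_nhds] at hc
  obtain ⟨r, hr, h⟩ := hc (ε / 2) (by positivity)
  filter_upwards [hφ.eventually (gt_mem_nhds hr)] with i hi
  have e : mollify (φ i) w - w = ∫ z, (φ i).normed volume z • (transl z w - w) := by
    simp only [smul_sub]
    rw [integral_sub (integrable_mollify _ w) ((φ i).integrable_normed.smul_const w),
      integral_smul_const, (φ i).integral_normed, one_smul, mollify_apply]
  rw [dist_eq_norm, e]
  refine lt_of_le_of_lt (norm_integral_le_of_norm_le
    ((φ i).integrable_normed.mul_const (ε / 2)) (.of_forall fun z => ?_)) ?_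
  · rw [norm_smul, Real.norm_of_nonneg ((φ i).nonneg_normed z)]
    by_cases hz : z ∈ Metric.ball (0 : Space N) (φ i).rOut
    · refine mul_le_mul_of_nonneg_left ?_ ((φ i).nonneg_normed z)
      rw [← dist_eq_norm]
      exact (h ((Metric.mem_ball.1 hz).trans hi)).le
    · rw [← (φ i).support_normed_eq (μ := volume), Function.notMem_support] at hz
      simp [hz]
  · rw [integral_mul_const, (φ i).integral_normed]
    linarith

/-- The difference is moved from the L² function to the bump, which is Lipschitz with compact
support. The factor ‖y‖ gained in this way is what compensates the singular kernel. -/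
theorem exists_norm_diffOp_mollify_le (δ : ℝ) :
    ∃ C : ℝ, 0 ≤ C ∧ ∀ y : Space N, ‖y‖ ≤ δ → ∀ w : L2 N,
      ‖diffOp y (mollify b w)‖ ≤ C * ‖w‖ * ‖y‖ := by
  obtain ⟨K, hK⟩ := (b.contDiff_normed (μ := volume) (n := 1)).lipschitzWith_of_hasCompactSupport
    b.hasCompactSupport_normed (by simp)
  refine ⟨K * volume.real (Metric.ball (0 : Space N) (b.rOut + δ)), by positivity,
    fun y hy w => ?_⟩
  have hi2 : Integrable (fun z => b.normed volume (z - y) • transl z w) := by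
    have := (integrable_mollify b (transl y w)).comp_sub_right y
    simpa only [transl_transl, sub_add_cancel] using this
  have e : diffOp y (mollify b w)
      = ∫ z, (b.normed volume z - b.normed volume (z - y)) • transl z w := by
    simp only [sub_smul]
    have e' := integral_sub_right_eq_self (μ := volume)
      (fun z => b.normed volume z • transl (z + y) w) y
    simp only [sub_add_cancel] at e'
    rw [integral_sub (integrable_mollify b w) hi2, diffOp_apply, transl_mollify, mollify_apply,
      mollify_apply, e']
    simp only [transl_transl]
  rw [e]
  set B := Metric.ball (0 : Space N) (b.rOut + δ)
  have hb : Integrable (B.indicator fun _ => K * ‖y‖ * ‖w‖) volume :=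
    (integrable_indicator_iff Metric.isOpen_ball.measurableSet).2
      (integrableOn_const (by simpa using Metric.isBounded_ball.measure_lt_top.ne))
  refine (norm_integral_le_of_norm_le hb (.of_forall fun z => ?_)).trans ?_
  · rw [norm_smul, LinearIsometry.norm_map]
    by_cases hz : z ∈ B
    · rw [indicator_of_mem hz]
      gcongr
      have := hK.dist_le_mul z (z - y)
      simpa [dist_eq_norm] using this
    · rw [indicator_of_notMem hz]
      have hz' : b.rOut + δ ≤ ‖z‖ := by simpa [B] using hz
      have z1 : b.normed volume z = 0 := by
        rw [← Function.notMem_support, b.support_normed_eq]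
        simp only [Metric.mem_ball, dist_zero_right, not_lt]
        linarith [norm_nonneg y]
      have z2 : b.normed volume (z - y) = 0 := by
        rw [← Function.notMem_support, b.support_normed_eq]
        simp only [Metric.mem_ball, dist_zero_right, not_lt]
        linarith [norm_sub_norm_le z y]
      simp [z1, z2]
  · rw [integral_indicator Metric.isOpen_ball.measurableSet, setIntegral_const, smul_eq_mul]
    exact le_of_eq (by ring)

end Translations

/-! ### The nonlocal gradient as a closed operator -/

section Energy

open Filter Topology
open scoped RealInnerProductSpace

theorem eLpNorm_two_sq {X E : Type*} [MeasurableSpace X] [NormedAddCommGroup E] {μ : Measure X}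
    (f : X → E) : eLpNorm f 2 μ ^ 2 = ∫⁻ x, ‖f x‖ₑ ^ 2 ∂μ := by
  have := eLpNorm_nnreal_pow_eq_lintegral (f := f) (μ := μ) (p := 2) two_ne_zero
  simpa using this

theorem Lp_enorm_sq {X E : Type*} [MeasurableSpace X] [NormedAddCommGroup E] {μ : Measure X}
    (f : Lp E 2 μ) : ‖f‖ₑ ^ 2 = ∫⁻ x, ‖f x‖ₑ ^ 2 ∂μ := by
  rw [Lp.enorm_def, eLpNorm_two_sq]

variable {N : ℕ}

/-- The measure `|y|^{-(N + 2α)} dy` on the ball of radius `δ`. -/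
def kernelMeasure (N : ℕ) (δ α : ℝ) : Measure (Space N) :=
  (volume.restrict (Metric.ball (0 : Space N) δ)).withDensity
    fun y => ENNReal.ofReal (‖y‖ ^ ((N : ℝ) + 2 * α))⁻¹

theorem measurable_kernel (N : ℕ) (α : ℝ) :
    Measurable fun y : Space N => ENNReal.ofReal (‖y‖ ^ ((N : ℝ) + 2 * α))⁻¹ := by
  fun_prop

theorem ae_kernelMeasure_norm_le (N : ℕ) (δ α : ℝ) : ∀ᵐ y ∂kernelMeasure N δ α, ‖y‖ ≤ δ := by
  refine (withDensity_absolutelyContinuous _ _).ae_le ?_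
  filter_upwards [ae_restrict_mem Metric.isOpen_ball.measurableSet] with y hy
  simpa using (Metric.mem_ball.1 hy).le

/-- The integrand is |y|^{2 - N - 2α}, integrable at the origin because α < 1. -/
theorem memLp_norm_kernelMeasure (N : ℕ) (δ : ℝ) {α : ℝ} (hα : α < 1) :
    MemLp (fun y : Space N => ‖y‖) 2 (kernelMeasure N δ α) := by
  refine ⟨by fun_prop, ?_⟩
  suffices h : eLpNorm (fun y : Space N => ‖y‖) 2 (kernelMeasure N δ α) ^ 2 < ∞ from
    (ENNReal.pow_lt_top_iff.1 h).resolve_right two_ne_zero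
  rw [eLpNorm_two_sq, kernelMeasure,
    lintegral_withDensity_eq_lintegral_mul _ (measurable_kernel N α) (by fun_prop)]
  -- The radial criterion requires positive dimension; in dimension zero the norm vanishes
  -- identically.
  rcases Nat.eq_zero_or_pos N with rfl | hN
  · have : ∀ y : Space 0, ‖y‖ = 0 := fun y => by rw [Subsingleton.elim y 0, norm_zero]
    simp [this]
  · set s : ℝ := (N : ℝ) + 2 * α with hs
    have hint : IntegrableOn (fun y : Space N => (‖y‖ ^ s)⁻¹ * ‖y‖ ^ 2) (Metric.ball 0 δ) := by
      refine integrableOn_ball_of_norm_le_rpow (C := 1) (α := s - 2)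
        (by rw [finrank_euclideanSpace, Fintype.card_fin]; exact hN)
        (by simp [hs]; linarith) (.of_forall fun y => ?_) (by fun_prop)
      rcases eq_or_ne y 0 with rfl | hy
      · simp; positivity
      · have hy' : 0 < ‖y‖ := norm_pos_iff.2 hy
        rw [Real.norm_of_nonneg (by positivity), one_mul, ← Real.rpow_neg hy'.le,
          ← Real.rpow_natCast ‖y‖ 2, ← Real.rpow_add hy']
        refine le_of_eq ?_
        congr 1
        push_cast
        ring
    refine lt_of_le_of_lt (lintegral_mono fun y => ?_) hint.2
    simp only [Pi.mul_apply, enorm_norm]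
    rw [enorm_mul, enorm_pow, enorm_norm, Real.enorm_of_nonneg (by positivity)]

/-- The operators `diffOp y` as an almost everywhere defined function of `y`. -/
abbrev GradSpace (N : ℕ) (δ α : ℝ) : Type := Lp (L2 N) 2 (kernelMeasure N δ α)

/-- The graph of `w ↦ (y ↦ w - w(· - y))`, as an operator into `L²(kernelMeasure; L²)`. -/
def IsNonlocalGrad {δ α : ℝ} (w : L2 N) (k : GradSpace N δ α) : Prop :=
  k =ᵐ[kernelMeasure N δ α] fun y => diffOp y w

theorem nonlocalEnergy_congr {δ α : ℝ} {w w' : Space N → Space N} (h : w =ᵐ[volume] w') :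
    nonlocalEnergy δ α w = nonlocalEnergy δ α w' := by
  refine lintegral_congr_ae ?_
  filter_upwards [h] with x hx
  refine lintegral_congr_ae (ae_restrict_of_ae ?_)
  filter_upwards [(Measure.measurePreserving_sub_left volume x).quasiMeasurePreserving.ae h]
    with y hy
  rw [hx, hy]

/-- Tonelli with y outside: the energy becomes the squared norm of y ↦ D_y w, a continuous map into
L², so Hilbert space methods apply. -/
theorem nonlocalEnergy_eq_lintegral (δ α : ℝ) (w : L2 N) :
    nonlocalEnergy δ α w = ∫⁻ y, ‖diffOp y w‖ₑ ^ 2 ∂kernelMeasure N δ α := by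
  have hw : Measurable w := (Lp.stronglyMeasurable w).measurable
  have hm : Measurable fun y : Space N => ‖diffOp y w‖ₑ ^ 2 :=
    (continuous_diffOp w).enorm.measurable.pow_const 2
  rw [nonlocalEnergy, lintegral_lintegral_swap (by fun_prop), kernelMeasure,
    lintegral_withDensity_eq_lintegral_mul _ (measurable_kernel N α) hm]
  refine lintegral_congr fun y => ?_
  rw [Pi.mul_apply, Lp_enorm_sq, ← lintegral_const_mul _ (by fun_prop)]
  refine lintegral_congr_ae ?_
  filter_upwards [diffOp_coeFn y w] with x hx
  rw [hx, div_eq_inv_mul, ENNReal.ofReal_mul (by positivity), ENNReal.ofReal_pow (norm_nonneg _),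
    ofReal_norm]

theorem memLp_diffOp_iff {δ α : ℝ} {w : L2 N} :
    MemLp (fun y => diffOp y w) 2 (kernelMeasure N δ α) ↔ nonlocalEnergy δ α w < ∞ := by
  rw [nonlocalEnergy_eq_lintegral, ← eLpNorm_two_sq, ENNReal.pow_lt_top_iff,
    or_iff_left two_ne_zero]
  exact ⟨fun h => h.2, fun h => ⟨(continuous_diffOp w).aestronglyMeasurable, h⟩⟩

theorem exists_isNonlocalGrad {δ α : ℝ} {w : L2 N} (h : nonlocalEnergy δ α w < ∞) :
    ∃ k : GradSpace N δ α, IsNonlocalGrad w k :=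
  ⟨(memLp_diffOp_iff.2 h).toLp _, MemLp.coeFn_toLp _⟩

theorem IsNonlocalGrad.nonlocalEnergy_eq {δ α : ℝ} {w : L2 N} {k : GradSpace N δ α}
    (h : IsNonlocalGrad w k) : nonlocalEnergy δ α w = ENNReal.ofReal (‖k‖ ^ 2) := by
  rw [ENNReal.ofReal_pow (norm_nonneg _), ofReal_norm, Lp_enorm_sq, nonlocalEnergy_eq_lintegral]
  refine lintegral_congr_ae ?_
  filter_upwards [h] with y hy
  rw [hy]

theorem IsNonlocalGrad.sub {δ α : ℝ} {w w' : L2 N} {k k' : GradSpace N δ α}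
    (h : IsNonlocalGrad w k) (h' : IsNonlocalGrad w' k') : IsNonlocalGrad (w - w') (k - k') := by
  filter_upwards [h, h', Lp.coeFn_sub k k'] with y h1 h2 h3
  rw [h3, Pi.sub_apply, h1, h2, map_sub]

variable (δ : ℝ) {α : ℝ}

theorem memLp_diffOp_mollify (hα : α < 1) (b : ContDiffBump (0 : Space N)) (w : L2 N) :
    MemLp (fun y => diffOp y (mollify b w)) 2 (kernelMeasure N δ α) := by
  obtain ⟨C, -, hC⟩ := exists_norm_diffOp_mollify_le b δ
  refine MemLp.of_le_mul (memLp_norm_kernelMeasure N δ hα)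
    (continuous_diffOp _).aestronglyMeasurable (c := C * ‖w‖) ?_
  filter_upwards [ae_kernelMeasure_norm_le N δ α] with y hy
  rw [norm_norm]
  exact hC y hy w

/-- The nonlocal gradient of the mollification, as a bounded operator. -/
def gradMollify (hα : α < 1) (b : ContDiffBump (0 : Space N)) : L2 N →L[ℝ] GradSpace N δ α :=
  LinearMap.mkContinuousOfExistsBound
    { toFun := fun w => (memLp_diffOp_mollify δ hα b w).toLp _
      map_add' := fun w v => by
        rw [← MemLp.toLp_add]
        congr 1
        ext1 y
        simp
      map_smul' := fun a w => by
        rw [RingHom.id_apply, ← MemLp.toLp_const_smul]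
        congr 1
        ext1 y
        simp } (by
    obtain ⟨C, hC0, hC⟩ := exists_norm_diffOp_mollify_le b δ
    refine ⟨C * ‖(memLp_norm_kernelMeasure N δ hα).toLp _‖, fun w => ?_⟩
    rw [mul_right_comm]
    refine Lp.norm_le_mul_norm_of_ae_le_mul ?_
    filter_upwards [ae_kernelMeasure_norm_le N δ α,
      (memLp_diffOp_mollify δ hα b w).coeFn_toLp,
      (memLp_norm_kernelMeasure N δ hα).coeFn_toLp] with y hy h1 h2
    change ‖(memLp_diffOp_mollify δ hα b w).toLp _ y‖ ≤ _
    rw [h1, h2, norm_norm]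
    exact hC y hy w)

variable {δ}

theorem gradMollify_coeFn (hα : α < 1) (b : ContDiffBump (0 : Space N)) (w : L2 N) :
    gradMollify δ hα b w =ᵐ[kernelMeasure N δ α] fun y => diffOp y (mollify b w) :=
  (memLp_diffOp_mollify δ hα b w).coeFn_toLp

theorem inner_gradMollify (hα : α < 1) (b b' : ContDiffBump (0 : Space N)) (w w' : L2 N) :
    ⟪gradMollify δ hα b w, gradMollify δ hα b' w'⟫
      = ∫ y, ⟪diffOp y (mollify b w), diffOp y (mollify b' w')⟫ ∂kernelMeasure N δ α := by
  rw [L2.inner_def]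
  refine integral_congr_ae ?_
  filter_upwards [gradMollify_coeFn hα b w, gradMollify_coeFn hα b' w'] with y h1 h2
  rw [h1, h2]

/-- Dominated convergence in y: each D_y is continuous on L², and the assumed bound gives ‖D_y(w_i -
u)‖ ≤ 2‖D_y u‖, which is square integrable. -/
theorem tendsto_of_isNonlocalGrad {ι : Type*} {l : Filter ι} [l.IsCountablyGenerated]
    {w : ι → L2 N} {u : L2 N} {k : ι → GradSpace N δ α} {k₀ : GradSpace N δ α}
    (hk : ∀ i, IsNonlocalGrad (w i) (k i)) (hk₀ : IsNonlocalGrad u k₀)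
    (hb : ∀ i y, ‖diffOp y (w i)‖ ≤ ‖diffOp y u‖)
    (hw : Tendsto w l (𝓝 u)) : Tendsto k l (𝓝 k₀) := by
  rw [tendsto_iff_edist_tendsto_0]
  have key : Tendsto (fun i => ‖k i - k₀‖ₑ ^ 2) l (𝓝 0) := by
    have e : ∀ i, ‖k i - k₀‖ₑ ^ 2 = ∫⁻ y, ‖diffOp y (w i - u)‖ₑ ^ 2 ∂kernelMeasure N δ α :=
      fun i => by
        rw [Lp_enorm_sq]
        refine lintegral_congr_ae ?_
        filter_upwards [(hk i).sub hk₀] with y hy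
        rw [hy]
    simp only [e]
    have hfin : ∫⁻ y, (2 * ‖diffOp y u‖ₑ) ^ 2 ∂kernelMeasure N δ α ≠ ∞ := by
      have h1 := hk₀.nonlocalEnergy_eq
      rw [nonlocalEnergy_eq_lintegral] at h1
      simp only [mul_pow]
      rw [lintegral_const_mul _ ((continuous_diffOp u).enorm.measurable.pow_const 2), h1]
      exact ENNReal.mul_ne_top (by simp) ENNReal.ofReal_ne_top
    have := tendsto_lintegral_filter_of_dominated_convergence (μ := kernelMeasure N δ α) (l := l)
      (F := fun i y => ‖diffOp y (w i - u)‖ₑ ^ 2) (f := fun _ => 0)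
      (fun y => (2 * ‖diffOp y u‖ₑ) ^ 2)
      (.of_forall fun i => (continuous_diffOp _).enorm.measurable.pow_const 2)
      (.of_forall fun i => .of_forall fun y => ?_) hfin (.of_forall fun y => ?_)
    · simpa using this
    · gcongr
      rw [map_sub, two_mul]
      refine enorm_sub_le.trans (add_le_add_left ?_ _)
      rw [enorm_le_iff_norm_le]
      exact hb i y
    · have h1 : Tendsto (fun i => ‖diffOp y (w i - u)‖ₑ) l (𝓝 0) := by
        have := ((diffOp y).continuous.tendsto 0).comp (by simpa using hw.sub_const u :
          Tendsto (fun i => w i - u) l (𝓝 0))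
        simpa using this.enorm
      simpa [Function.comp_def] using ((ENNReal.continuous_pow 2).tendsto 0).comp h1
  have : Tendsto (fun i => (‖k i - k₀‖ₑ ^ 2) ^ (1 / 2 : ℝ)) l (𝓝 0) := by
    have := (ENNReal.continuous_rpow_const (y := (1 / 2 : ℝ))).tendsto 0 |>.comp key
    simpa [Function.comp_def] using this
  refine this.congr fun i => ?_
  rw [← ENNReal.rpow_natCast, ← ENNReal.rpow_mul, edist_eq_enorm_sub]
  norm_num

/-- The algebraic properties come from mollification being self-adjoint and commuting with every
D_y. For closedness, convergence in L² gives almost everywhere convergence in y along a subsequence,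
where continuity of each D_y identifies the limit. -/
theorem isMollifier_mollify (hα : α < 1) {φ : ℕ → ContDiffBump (0 : Space N)}
    (hφ : Tendsto (fun n => (φ n).rOut) atTop (𝓝 0)) :
    IsMollifier (fun n => mollify (φ n)) (fun n => gradMollify δ hα (φ n))
      (IsNonlocalGrad (δ := δ) (α := α)) where
  norm_le n w := norm_mollify_le _ w
  tendsto w := tendsto_mollify hφ w
  symm n w v := inner_mollify_left _ w v
  form i j w k := by
    simp only [inner_gradMollify]
    refine integral_congr_ae (.of_forall fun y => ?_)
    simp only [diffOp_mollify, inner_mollify_left]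
  graph u k h := by
    have cube : Tendsto (fun n => mollify (φ n) (mollify (φ n) (mollify (φ n) u))) atTop (𝓝 u) := by
      have hR := fun n w => norm_mollify_le (φ n) w
      have h1 := tendsto_mollify hφ u
      exact tendsto_apply_of_norm_le hR h1 (tendsto_apply_of_norm_le hR h1 h1)
    refine tendsto_of_isNonlocalGrad (fun n => gradMollify_coeFn hα _ _) h (fun n y => ?_) cube
    simp only [diffOp_mollify]
    exact (norm_mollify_le _ _).trans ((norm_mollify_le _ _).trans (norm_mollify_le _ _))
  closed w u k hw hk := by
    obtain ⟨ns, hns, hae⟩ := (tendstoInMeasure_of_tendsto_Lp hk).exists_seq_tendsto_ae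
    have hall : ∀ᵐ y ∂kernelMeasure N δ α, ∀ n,
        gradMollify δ hα (φ n) (w n) y = diffOp y (mollify (φ n) (w n)) :=
      ae_all_iff.2 fun n => gradMollify_coeFn hα _ _
    filter_upwards [hae, hall] with y h1 h2
    refine tendsto_nhds_unique h1 ?_
    simp only [h2]
    exact ((diffOp y).continuous.tendsto u).comp (hw.comp hns.tendsto_atTop)

end Energy

/-! ### The nonlinear part of the force as a Lipschitz operator on L² -/

section Perturbation

open Filter Topology
open scoped RealInnerProductSpace

theorem lintegral_mul_sq_le {X : Type*} [MeasurableSpace X] {μ : Measure X} {f g : X → ℝ≥0∞}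
    (hf : AEMeasurable f μ) (hg : AEMeasurable g μ) :
    (∫⁻ x, f x * g x ∂μ) ^ 2 ≤ (∫⁻ x, f x ^ 2 ∂μ) * ∫⁻ x, g x ^ 2 ∂μ := by
  have h := ENNReal.lintegral_mul_le_Lp_mul_Lq μ Real.HolderConjugate.two_two hf hg
  have e : ∀ a : ℝ≥0∞, (a ^ (1 / 2 : ℝ)) ^ 2 = a := fun a => by
    rw [← ENNReal.rpow_natCast, ← ENNReal.rpow_mul]; norm_num
  calc _ ≤ ((∫⁻ x, f x ^ (2 : ℝ) ∂μ) ^ (1 / 2 : ℝ)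
        * (∫⁻ x, g x ^ (2 : ℝ) ∂μ) ^ (1 / 2 : ℝ)) ^ 2 := by
        gcongr
        exact h
    _ = _ := by
        rw [mul_pow, e, e]
        simp only [ENNReal.rpow_two]

variable {N : ℕ} {δ : ℝ}

/-- The product of Lebesgue measure on `ℝ^N` and on the ball of radius `δ`. -/
def pairMeasure (N : ℕ) (δ : ℝ) : Measure (Space N × Space N) :=
  (volume : Measure (Space N)).prod (volume.restrict (Metric.ball (0 : Space N) δ))

theorem ae_pairMeasure_of_ae {P : Space N → Prop} (h : ∀ᵐ x, P x) :
    ∀ᵐ p ∂pairMeasure N δ, P p.1 ∧ P (p.1 - p.2) := by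
  filter_upwards [Measure.quasiMeasurePreserving_fst.ae h,
    (quasiMeasurePreserving_sub_of_right_invariant volume _).ae h] with p h1 h2
  exact ⟨h1, h2⟩

/-- The pointwise difference of an `L²` function as a function of two variables. -/
def pairDiff (w : L2 N) (p : Space N × Space N) : Space N := w p.1 - w (p.1 - p.2)

theorem measurable_pairDiff (w : L2 N) : Measurable (pairDiff w) := by
  have hw : Measurable w := (Lp.stronglyMeasurable w).measurable
  unfold pairDiff
  fun_prop

theorem pairDiff_add (w v : L2 N) :
    pairDiff (w + v) =ᵐ[pairMeasure N δ] fun p => pairDiff w p + pairDiff v p := by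
  filter_upwards [ae_pairMeasure_of_ae (Lp.coeFn_add w v)] with p hp
  simp only [pairDiff, hp.1, hp.2, Pi.add_apply]
  abel

theorem pairDiff_smul (a : ℝ) (w : L2 N) :
    pairDiff (a • w) =ᵐ[pairMeasure N δ] fun p => a • pairDiff w p := by
  filter_upwards [ae_pairMeasure_of_ae (Lp.coeFn_smul a w)] with p hp
  simp only [pairDiff, hp.1, hp.2, Pi.smul_apply, smul_sub]

theorem pairDiff_sub (w v : L2 N) :
    pairDiff (w - v) =ᵐ[pairMeasure N δ] fun p => pairDiff w p - pairDiff v p := by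
  filter_upwards [ae_pairMeasure_of_ae (Lp.coeFn_sub w v)] with p hp
  simp only [pairDiff, hp.1, hp.2, Pi.sub_apply]
  abel

@[simp]
theorem pairDiff_zero (p : Space N × Space N) : pairDiff 0 p = 0 := by
  simp [pairDiff]

theorem lintegral_pairDiff_mul_le (w h : L2 N) (y : Space N) :
    ∫⁻ x, ‖pairDiff w (x, y)‖ₑ * ‖pairDiff h (x, y)‖ₑ ≤ ‖diffOp y w‖ₑ * ‖diffOp y h‖ₑ := by
  have e : ∀ w : L2 N, ∫⁻ x, ‖pairDiff w (x, y)‖ₑ ^ 2 = ‖diffOp y w‖ₑ ^ 2 := fun w => by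
    rw [Lp_enorm_sq]
    refine lintegral_congr_ae ?_
    filter_upwards [diffOp_coeFn y w] with x hx
    rw [hx, pairDiff]
  have hm : ∀ w : L2 N, Measurable fun x => ‖pairDiff w (x, y)‖ₑ := fun w =>
    ((measurable_pairDiff w).comp measurable_prodMk_right).enorm
  have := lintegral_mul_sq_le (μ := volume) (hm w).aemeasurable (hm h).aemeasurable
  rw [e, e, ← mul_pow] at this
  exact (ENNReal.pow_le_pow_left_iff two_ne_zero).1 this

/-- Tonelli with y outside, then Cauchy–Schwarz in x for each fixed y, reduces double integrals to
the L² norms of D_y. -/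
theorem lintegral_pairMeasure_le {F : Space N × Space N → ℝ} {c : Space N → ℝ≥0∞}
    (hc : AEMeasurable c (volume.restrict (Metric.ball (0 : Space N) δ))) (w h : L2 N)
    (hF : ∀ᵐ p ∂pairMeasure N δ, ‖F p‖ₑ ≤ c p.2 * (‖pairDiff w p‖ₑ * ‖pairDiff h p‖ₑ)) :
    ∫⁻ p, ‖F p‖ₑ ∂pairMeasure N δ
      ≤ ∫⁻ y in Metric.ball (0 : Space N) δ, c y * (‖diffOp y w‖ₑ * ‖diffOp y h‖ₑ) := by
  have hm : Measurable fun p => ‖pairDiff w p‖ₑ * ‖pairDiff h p‖ₑ :=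
    (measurable_pairDiff w).enorm.mul (measurable_pairDiff h).enorm
  refine (lintegral_mono_ae hF).trans ?_
  have hcm : AEMeasurable (fun p : Space N × Space N => c p.2 * (‖pairDiff w p‖ₑ * ‖pairDiff h p‖ₑ))
      (pairMeasure N δ) :=
    (hc.comp_quasiMeasurePreserving Measure.quasiMeasurePreserving_snd).mul hm.aemeasurable
  rw [pairMeasure, lintegral_prod_symm _ hcm]
  refine lintegral_mono fun y => ?_
  have hm' : Measurable fun x => ‖pairDiff w (x, y)‖ₑ * ‖pairDiff h (x, y)‖ₑ :=
    hm.comp measurable_prodMk_right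
  dsimp only
  rw [lintegral_const_mul _ hm']
  gcongr
  exact lintegral_pairDiff_mul_le w h y

/-- Measurable nonlinear kernels, Lipschitz in the second variable with a square integrable
constant. -/
structure IsPerturbation (δ : ℝ) (k : Space N → Space N → Space N) (g : Space N → ℝ) : Prop where
  measurable : Measurable (Function.uncurry k)
  zero : ∀ y, k y 0 = 0
  lipschitz : ∀ y a b, ‖k y a - k y b‖ ≤ g y * ‖a - b‖
  nonneg : ∀ y, 0 ≤ g y
  memLp : MemLp g 2 (volume.restrict (Metric.ball (0 : Space N) δ))

/-- The weighted first order difference `∫ g(y) ‖w - w(· - y)‖ dy`. -/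
def weightedDiff (δ : ℝ) (g : Space N → ℝ) (w : L2 N) : ℝ≥0∞ :=
  ∫⁻ y in Metric.ball (0 : Space N) δ, ‖g y‖ₑ * ‖diffOp y w‖ₑ

/-- The quadratic form of the perturbation. -/
def perturbForm (δ : ℝ) (k : Space N → Space N → Space N) (w h : L2 N) : ℝ :=
  -(1 / 2) * ∫ p, ⟪k p.2 (pairDiff w p), pairDiff h p⟫ ∂pairMeasure N δ

variable {k : Space N → Space N → Space N} {g : Space N → ℝ}

theorem enorm_diffOp_le (y : Space N) (w : L2 N) : ‖diffOp y w‖ₑ ≤ 2 * ‖w‖ₑ := by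
  have := ENNReal.ofReal_le_ofReal (norm_diffOp_le y w)
  rwa [ENNReal.ofReal_mul zero_le_two, ofReal_norm, ofReal_norm, ENNReal.ofReal_ofNat] at this

namespace IsPerturbation

variable (hk : IsPerturbation δ k g)
include hk

theorem lintegral_enorm_lt_top :
    ∫⁻ y in Metric.ball (0 : Space N) δ, ‖g y‖ₑ < ∞ := by
  have : IsFiniteMeasure (volume.restrict (Metric.ball (0 : Space N) δ)) :=
    ⟨by rw [Measure.restrict_apply_univ]; exact measure_ball_lt_top⟩
  exact (hk.memLp.integrable one_le_two).2

theorem weightedDiff_le (w : L2 N) :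
    weightedDiff δ g w ≤ 2 * ‖w‖ₑ * ∫⁻ y in Metric.ball (0 : Space N) δ, ‖g y‖ₑ := by
  rw [weightedDiff, mul_comm, ← lintegral_mul_const' _ _ (by finiteness)]
  gcongr
  exact enorm_diffOp_le _ _

theorem weightedDiff_lt_top (w : L2 N) : weightedDiff δ g w < ∞ :=
  (hk.weightedDiff_le w).trans_lt
    (ENNReal.mul_lt_top (by finiteness) hk.lintegral_enorm_lt_top)

theorem measurable_comp (w : L2 N) : Measurable fun p => k p.2 (pairDiff w p) :=
  hk.measurable.comp (measurable_snd.prodMk (measurable_pairDiff w))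

/-- The factor D_y h is estimated crudely by 2‖h‖. This loses nothing that matters and makes the
form bounded in h on all of L², not just on the energy space. -/
theorem lintegral_sub_le (w w' h : L2 N) :
    ∫⁻ p, ‖⟪k p.2 (pairDiff w p) - k p.2 (pairDiff w' p), pairDiff h p⟫‖ₑ ∂pairMeasure N δ
      ≤ 2 * ‖h‖ₑ * weightedDiff δ g (w - w') := by
  have hg := hk.memLp.aestronglyMeasurable.enorm
  refine (lintegral_pairMeasure_le hg (w - w') h ?_).trans ?_
  · filter_upwards [pairDiff_sub w w'] with p hp
    rw [hp]
    have h1 : ‖⟪k p.2 (pairDiff w p) - k p.2 (pairDiff w' p), pairDiff h p⟫‖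
        ≤ g p.2 * (‖pairDiff w p - pairDiff w' p‖ * ‖pairDiff h p‖) := by
      rw [← mul_assoc]
      exact (norm_inner_le_norm _ _).trans (by gcongr; exact hk.lipschitz _ _ _)
    have h2 := ENNReal.ofReal_le_ofReal h1
    rwa [ENNReal.ofReal_mul (hk.nonneg _), ENNReal.ofReal_mul (norm_nonneg _), ofReal_norm,
      ofReal_norm, ofReal_norm, ← Real.enorm_of_nonneg (hk.nonneg _)] at h2
  · rw [weightedDiff, mul_comm, ← lintegral_mul_const' _ _ (by finiteness)]
    refine lintegral_mono fun y => ?_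
    rw [mul_assoc]
    gcongr
    exact enorm_diffOp_le _ _

theorem integrable (w h : L2 N) :
    Integrable (fun p => ⟪k p.2 (pairDiff w p), pairDiff h p⟫) (pairMeasure N δ) := by
  refine ⟨((hk.measurable_comp w).inner (measurable_pairDiff h)).aestronglyMeasurable, ?_⟩
  refine lt_of_le_of_lt (lintegral_mono fun p => ?_)
    ((hk.lintegral_sub_le w 0 h).trans_lt
      (ENNReal.mul_lt_top (by finiteness) (hk.weightedDiff_lt_top _)))
  rw [pairDiff_zero, hk.zero, sub_zero]

/-- The factor 1/2 in the pairing absorbs the 2 in ‖D_y h‖ ≤ 2‖h‖, so the constant is exactly one.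
-/
theorem norm_perturbForm_sub_le (w w' h : L2 N) :
    ‖perturbForm δ k w h - perturbForm δ k w' h‖ ≤ (weightedDiff δ g (w - w')).toReal * ‖h‖ := by
  rw [perturbForm, perturbForm, ← mul_sub, ← integral_sub (hk.integrable w h) (hk.integrable w' h),
    norm_mul]
  simp only [← inner_sub_left]
  have h1 := hk.lintegral_sub_le w w' h
  have hfin : 2 * ‖h‖ₑ * weightedDiff δ g (w - w') ≠ ∞ :=
    (ENNReal.mul_lt_top (by finiteness) (hk.weightedDiff_lt_top _)).ne
  have h2 := (norm_integral_le_lintegral_norm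
    (fun p => ⟪k p.2 (pairDiff w p) - k p.2 (pairDiff w' p), pairDiff h p⟫)
      (μ := pairMeasure N δ)).trans (ENNReal.toReal_mono hfin
        (by simpa only [ofReal_norm] using h1))
  rw [ENNReal.toReal_mul, ENNReal.toReal_mul, toReal_enorm, ENNReal.toReal_ofNat] at h2
  rw [norm_neg, norm_div, norm_one, Real.norm_ofNat]
  linarith

theorem perturbForm_add (w h h' : L2 N) :
    perturbForm δ k w (h + h') = perturbForm δ k w h + perturbForm δ k w h' := by
  rw [perturbForm, perturbForm, perturbForm, ← mul_add,
    ← integral_add (hk.integrable w h) (hk.integrable w h')]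
  refine congrArg (fun r : ℝ => -(1 / 2) * r) (integral_congr_ae ?_)
  filter_upwards [pairDiff_add h h'] with p hp
  rw [hp, inner_add_right]

theorem perturbForm_smul (w : L2 N) (a : ℝ) (h : L2 N) :
    perturbForm δ k w (a • h) = a * perturbForm δ k w h := by
  rw [perturbForm, perturbForm, mul_left_comm, ← integral_const_mul a]
  refine congrArg (fun r : ℝ => -(1 / 2) * r) (integral_congr_ae ?_)
  filter_upwards [pairDiff_smul a h] with p hp
  rw [hp, real_inner_smul_right]

/-- For fixed w the form is a bounded linear functional of h, represented by Riesz; the difference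
estimate follows on testing with P w - P w' itself. -/
theorem exists_operator : ∃ P : L2 N → L2 N, (∀ w h, ⟪P w, h⟫ = perturbForm δ k w h) ∧
    ∀ w w', ‖P w - P w'‖ ≤ (weightedDiff δ g (w - w')).toReal := by
  have h0 : ∀ h, perturbForm δ k 0 h = 0 := fun h => by
    simp [perturbForm, hk.zero]
  let ℓ : L2 N → (L2 N →L[ℝ] ℝ) := fun w => LinearMap.mkContinuous
    { toFun := perturbForm δ k w
      map_add' := hk.perturbForm_add w
      map_smul' := hk.perturbForm_smul w } (weightedDiff δ g (w - 0)).toReal fun h => by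
    have := hk.norm_perturbForm_sub_le w 0 h
    rwa [h0, sub_zero] at this
  have hP : ∀ w h, ⟪(InnerProductSpace.toDual ℝ (L2 N)).symm (ℓ w), h⟫ = perturbForm δ k w h :=
    fun w h => InnerProductSpace.toDual_symm_apply
  refine ⟨fun w => (InnerProductSpace.toDual ℝ (L2 N)).symm (ℓ w), hP, fun w w' => ?_⟩
  set v := (InnerProductSpace.toDual ℝ (L2 N)).symm (ℓ w)
    - (InnerProductSpace.toDual ℝ (L2 N)).symm (ℓ w') with hv
  have h1 : ‖v‖ * ‖v‖ ≤ (weightedDiff δ g (w - w')).toReal * ‖v‖ := by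
    rw [← real_inner_self_eq_norm_mul_norm]
    nth_rewrite 1 [hv]
    rw [inner_sub_left, hP, hP]
    exact (le_abs_self _).trans (hk.norm_perturbForm_sub_le w w' v)
  rcases (norm_nonneg v).eq_or_lt with h | h
  · rw [← h]; positivity
  · exact le_of_mul_le_mul_right h1 h

/-- With s = N + 2α, Cauchy–Schwarz is applied to g |y|^{s/2} times |y|^{-s/2} ‖D_y w‖. This is
where the constant λ of the theorem arises. -/
theorem weightedDiff_sq_le {α : ℝ} (hα : 0 < α) (w : L2 N) :
    weightedDiff δ g w ^ 2 ≤ ENNReal.ofReal (growthRate δ α g) * nonlocalEnergy δ α w := by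
  set s : ℝ := (N : ℝ) + 2 * α with hs
  have hs0 : 0 < s := by positivity
  have hg := hk.memLp.aestronglyMeasurable
  have hsq : ∀ y : Space N, (‖y‖ ^ (s / 2)) ^ 2 = ‖y‖ ^ s := fun y => by
    rw [← Real.rpow_natCast, ← Real.rpow_mul (norm_nonneg _)]; norm_num
  have e : weightedDiff δ g w = ∫⁻ y in Metric.ball (0 : Space N) δ,
      (‖g y‖ₑ * ENNReal.ofReal (‖y‖ ^ (s / 2)))
        * (ENNReal.ofReal (‖y‖ ^ (s / 2))⁻¹ * ‖diffOp y w‖ₑ) := by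
    refine lintegral_congr fun y => ?_
    -- At the origin the two weights do not cancel, but D_0 = 0 and both sides vanish.
    rcases eq_or_ne y 0 with rfl | hy
    · simp [diffOp_apply, transl_zero]
    · have : 0 < ‖y‖ ^ (s / 2) := Real.rpow_pos_of_pos (norm_pos_iff.2 hy) _
      rw [mul_assoc, ← mul_assoc (ENNReal.ofReal _), ← ENNReal.ofReal_mul this.le,
        mul_inv_cancel₀ this.ne', ENNReal.ofReal_one, one_mul]
  have hint : IntegrableOn (fun y => g y ^ 2 * ‖y‖ ^ s) (Metric.ball (0 : Space N) δ) := by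
    refine (hk.memLp.integrable_sq).mul_bdd (c := δ ^ s)
      (Measurable.aestronglyMeasurable (by fun_prop)) ?_
    filter_upwards [ae_restrict_mem Metric.isOpen_ball.measurableSet] with y hy
    rw [Real.norm_of_nonneg (by positivity)]
    exact Real.rpow_le_rpow (norm_nonneg _) (by simpa using (Metric.mem_ball.1 hy).le) hs0.le
  have e1 : ENNReal.ofReal (growthRate δ α g) = ∫⁻ y in Metric.ball (0 : Space N) δ,
      (‖g y‖ₑ * ENNReal.ofReal (‖y‖ ^ (s / 2))) ^ 2 := by
    rw [growthRate, ofReal_integral_eq_lintegral_ofReal hint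
      (.of_forall fun y => by positivity)]
    refine lintegral_congr fun y => ?_
    rw [mul_pow, ENNReal.ofReal_mul (sq_nonneg _), Real.enorm_of_nonneg (hk.nonneg y),
      ← ENNReal.ofReal_pow (hk.nonneg y), ← ENNReal.ofReal_pow (by positivity), hsq]
  have e2 : nonlocalEnergy δ α w = ∫⁻ y in Metric.ball (0 : Space N) δ,
      (ENNReal.ofReal (‖y‖ ^ (s / 2))⁻¹ * ‖diffOp y w‖ₑ) ^ 2 := by
    rw [nonlocalEnergy_eq_lintegral, kernelMeasure, lintegral_withDensity_eq_lintegral_mul _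
      (measurable_kernel N α) ((continuous_diffOp w).enorm.measurable.pow_const 2)]
    refine lintegral_congr fun y => ?_
    rw [Pi.mul_apply, mul_pow, ← ENNReal.ofReal_pow (by positivity), inv_pow, hsq]
  rw [e, e1, e2]
  have hd : Measurable fun y => ‖diffOp y w‖ₑ := (continuous_diffOp w).enorm.measurable
  refine lintegral_mul_sq_le (hg.enorm.mul (by fun_prop)) ?_
  exact (Measurable.mul (by fun_prop) hd).aemeasurable

end IsPerturbation

end Perturbation

/-! ### Splitting the force; the energetic pairing in Hilbert space form -/

section Force

open Filter Topology
open scoped RealInnerProductSpace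

variable {N : ℕ} {δ κ α : ℝ} {f : Space N → Space N → Space N} {Φ Ψ : Space N → Space N → ℝ}
  {g : Space N → ℝ}

theorem enorm_inner_le_mul {E : Type*} [NormedAddCommGroup E] [InnerProductSpace ℝ E] (a b : E) :
    ‖⟪a, b⟫‖ₑ ≤ ‖a‖ₑ * ‖b‖ₑ := by
  have := ENNReal.ofReal_le_ofReal (norm_inner_le_norm (𝕜 := ℝ) a b)
  rwa [ENNReal.ofReal_mul (norm_nonneg _), ofReal_norm, ofReal_norm, ofReal_norm] at this

open scoped Classical in
/-- The nonlinear part `∇_u Ψ` of the force. -/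
def perturbKernel (κ α : ℝ) (f : Space N → Space N → Space N) (y u : Space N) : Space N :=
  if y = 0 then 0 else f y u - (2 * κ * (‖y‖ ^ ((N : ℝ) + 2 * α))⁻¹) • u

theorem ForceAssumptions.hasGradientAt_psi (hf : ForceAssumptions N κ α f Φ Ψ g) {y : Space N}
    (hy : y ≠ 0) (u : Space N) : HasGradientAt (Ψ y) (perturbKernel κ α f y u) u := by
  set s := ‖y‖ ^ ((N : ℝ) + 2 * α) with hs
  have e : Ψ y = fun u => Φ y u - κ * s⁻¹ * ‖u‖ ^ 2 := by
    ext u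
    rw [hf.potential_eq y hy u, ← hs]
    ring
  have h1 : HasFDerivAt (fun u : Space N => κ * s⁻¹ * ‖u‖ ^ 2)
      ((κ * s⁻¹) • ((2 : ℕ) • innerSL ℝ u)) u :=
    ((hasStrictFDerivAt_norm_sq u).hasFDerivAt).const_mul _
  have h2 := (hf.force_eq_gradient y hy u).hasFDerivAt.sub h1
  rw [e, hasGradientAt_iff_hasFDerivAt]
  refine h2.congr_fderiv ?_
  ext v
  simp only [perturbKernel, if_neg hy, ← hs]
  simp only [map_sub, map_smul, _root_.sub_apply, _root_.smul_apply,
    InnerProductSpace.toDual_apply_apply, innerSL_apply_apply, smul_eq_mul, nsmul_eq_mul]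
  push_cast
  ring

/-- Since Ψ(y, ·) attains its minimum at 0, its gradient vanishes there; the Hessian bound and the
mean value inequality give the Lipschitz constant g(y). Setting the kernel to 0 at y = 0 makes these
properties hold for every y and keeps joint measurability. -/
theorem ForceAssumptions.isPerturbation (hf : ForceAssumptions N κ α f Φ Ψ g) (δ : ℝ) :
    IsPerturbation δ (perturbKernel κ α f) g where
  measurable := by
    classical
    set Ω : Set (Space N × Space N) := {y : Space N | y ≠ 0} ×ˢ univ with hΩ
    have hc : ContinuousOn (fun p : Space N × Space N =>
        f p.1 p.2 - (2 * κ * (‖p.1‖ ^ ((N : ℝ) + 2 * α))⁻¹) • p.2) Ω := by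
      have h1 : ContinuousOn (fun p : Space N × Space N => ‖p.1‖ ^ ((N : ℝ) + 2 * α)) Ω :=
        continuousOn_fst.norm.rpow_const fun p hp => Or.inl (norm_ne_zero_iff.2 hp.1)
      have h2 : ∀ p ∈ Ω, ‖p.1‖ ^ ((N : ℝ) + 2 * α) ≠ 0 := fun p hp =>
        (Real.rpow_pos_of_pos (norm_pos_iff.2 hp.1) _).ne'
      have h3 : ContinuousOn (fun p : Space N × Space N =>
          2 * κ * (‖p.1‖ ^ ((N : ℝ) + 2 * α))⁻¹) Ω := (h1.inv₀ h2).const_smul (2 * κ)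
      exact hf.force_contDiffOn.continuousOn.sub (h3.smul continuousOn_snd)
    have hΩm : MeasurableSet Ω :=
      (isOpen_compl_singleton.measurableSet (s := ({0} : Set (Space N))ᶜ)).prod .univ
    have e : Function.uncurry (perturbKernel κ α f) = Ω.piecewise
        (fun p => f p.1 p.2 - (2 * κ * (‖p.1‖ ^ ((N : ℝ) + 2 * α))⁻¹) • p.2) (fun _ => 0) := by
      ext1 p
      by_cases hp : p.1 = 0 <;> simp [Function.uncurry, perturbKernel, Set.piecewise, hΩ, hp]
    rw [e]
    exact hc.measurable_piecewise continuousOn_const hΩm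
  zero y := by
    rcases eq_or_ne y 0 with rfl | hy
    · simp [perturbKernel]
    · have h1 : IsLocalMin (Ψ y) 0 := .of_forall fun u => by
        rw [hf.psi_zero y hy]; exact hf.psi_nonneg y hy u
      have h2 := h1.hasFDerivAt_eq_zero (hf.hasGradientAt_psi hy 0).hasFDerivAt
      simpa using h2
  lipschitz y a b := by
    rcases eq_or_ne y 0 with rfl | hy
    · have := hf.g_nonneg 0
      simp only [perturbKernel, if_true, sub_self, norm_zero]
      positivity
    · have hgrad : gradient (Ψ y) = perturbKernel κ α f y :=
        funext fun u => (hf.hasGradientAt_psi hy u).gradient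
      have hfy : ContDiff ℝ 1 (f y) := by
        have := hf.force_contDiffOn.comp (g := Function.uncurry f)
          (f := fun u : Space N => (y, u)) (s := univ)
          (contDiff_prodMk_right y).contDiffOn (fun u _ => ⟨hy, mem_univ _⟩)
        exact contDiffOn_univ.1 this
      have hd : Differentiable ℝ (perturbKernel κ α f y) := by
        have : perturbKernel κ α f y
            = fun u => f y u - (2 * κ * (‖y‖ ^ ((N : ℝ) + 2 * α))⁻¹) • u := by
          ext1 u; simp [perturbKernel, hy]
        rw [this]
        exact (hfy.differentiable one_ne_zero).fun_sub (by fun_prop)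
      have hb : ∀ u, ‖fderiv ℝ (perturbKernel κ α f y) u‖ ≤ g y := fun u => by
        rw [← hgrad]; exact hf.hessian_psi_le y hy u
      exact convex_univ.norm_image_sub_le_of_norm_fderiv_le (fun u _ => hd u) (fun u _ => hb u)
        (mem_univ b) (mem_univ a)
  nonneg := hf.g_nonneg
  memLp := (hf.g_locL2 _ (isCompact_closedBall 0 δ)).mono_measure
    (Measure.restrict_mono Metric.ball_subset_closedBall le_rfl)

theorem ae_force_eq (κ α : ℝ) (f : Space N → Space N → Space N) : ∀ᵐ y : Space N, ∀ u,
    f y u = (2 * κ * (‖y‖ ^ ((N : ℝ) + 2 * α))⁻¹) • u + perturbKernel κ α f y u := by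
  rcases subsingleton_or_nontrivial (Space N) with hN | hN
  · exact .of_forall fun y u => Subsingleton.elim _ _
  · have hne : ∀ᵐ y : Space N, y ≠ 0 := by simp [ae_iff]
    filter_upwards [hne] with y hy u
    simp [perturbKernel, hy]

/-- As Ψ ≥ 0, the potential dominates κ times the integrand of the energy. -/
theorem FiniteEnergyData.nonlocalEnergy_lt_top (hf : ForceAssumptions N κ α f Φ Ψ g)
    {u₀ v₀ : Space N → Space N} (h : FiniteEnergyData δ Φ u₀ v₀) :
    nonlocalEnergy δ α u₀ < ∞ := by
  refine lt_of_le_of_lt ?_ (ENNReal.mul_lt_top (ENNReal.ofReal_lt_top (r := κ⁻¹)) h.energy_lt_top)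
  rw [nonlocalEnergy, ← lintegral_const_mul' _ _ ENNReal.ofReal_ne_top]
  refine lintegral_mono fun x => ?_
  dsimp only
  rw [← lintegral_const_mul' _ _ ENNReal.ofReal_ne_top]
  refine lintegral_mono fun y => ?_
  dsimp only
  have hκ := hf.kappa_pos
  rcases eq_or_ne y 0 with rfl | hy
  · simp
  · rw [← ENNReal.ofReal_mul (by positivity)]
    refine ENNReal.ofReal_le_ofReal ?_
    rw [hf.potential_eq y hy, mul_add, mul_div_assoc, inv_mul_cancel_left₀ hκ.ne']
    have := hf.psi_nonneg y hy (u₀ x - u₀ (x - y))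
    have : 0 ≤ κ⁻¹ * Ψ y (u₀ x - u₀ (x - y)) := by positivity
    linarith

theorem inner_diffOp_eq_integral (w h : L2 N) (y : Space N) :
    ⟪diffOp y w, diffOp y h⟫ = ∫ x, ⟪pairDiff w (x, y), pairDiff h (x, y)⟫ := by
  rw [L2.inner_def]
  refine integral_congr_ae ?_
  filter_upwards [diffOp_coeFn y w, diffOp_coeFn y h] with x h1 h2
  rw [h1, h2, pairDiff, pairDiff]

theorem integral_kernelMeasure (F : Space N → ℝ) :
    ∫ y, F y ∂kernelMeasure N δ α
      = ∫ y in Metric.ball (0 : Space N) δ, (‖y‖ ^ ((N : ℝ) + 2 * α))⁻¹ * F y := by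
  rw [kernelMeasure, integral_withDensity_eq_integral_toReal_smul (measurable_kernel N α)
    (.of_forall fun y => ENNReal.ofReal_lt_top)]
  refine integral_congr_ae (.of_forall fun y => ?_)
  simp only [smul_eq_mul]
  rw [ENNReal.toReal_ofReal (by positivity)]

theorem integrable_singular_form {w h : L2 N} (hw : nonlocalEnergy δ α w < ∞)
    (hh : nonlocalEnergy δ α h < ∞) :
    Integrable (fun p : Space N × Space N => (‖p.2‖ ^ ((N : ℝ) + 2 * α))⁻¹
      * ⟪pairDiff w p, pairDiff h p⟫) (pairMeasure N δ) := by
  have hm : Measurable fun p => ⟪pairDiff w p, pairDiff h p⟫ :=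
    (measurable_pairDiff w).inner (measurable_pairDiff h)
  have hd : ∀ w : L2 N, Measurable fun y => ‖diffOp y w‖ₑ := fun w =>
    (continuous_diffOp w).enorm.measurable
  refine ⟨(Measurable.mul (by fun_prop) hm).aestronglyMeasurable, ?_⟩
  refine lt_of_le_of_lt (lintegral_pairMeasure_le (measurable_kernel N α).aemeasurable w h
    (.of_forall fun p => ?_)) ?_
  · rw [enorm_mul, Real.enorm_of_nonneg (by positivity)]
    gcongr
    exact enorm_inner_le_mul _ _
  · have h1 := lintegral_withDensity_eq_lintegral_mul
      (volume.restrict (Metric.ball (0 : Space N) δ)) (measurable_kernel N α)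
      ((hd w).mul (hd h))
    have h2 := lintegral_mul_sq_le (μ := kernelMeasure N δ α) (hd w).aemeasurable
      (hd h).aemeasurable
    rw [← nonlocalEnergy_eq_lintegral, ← nonlocalEnergy_eq_lintegral] at h2
    simp only [Pi.mul_apply] at h1
    rw [← h1]
    exact (ENNReal.pow_lt_top_iff.1 (h2.trans_lt (ENNReal.mul_lt_top hw hh))).resolve_right
      two_ne_zero

/-- The energetic pairing on the energy space. -/
theorem pairingK_eq (hf : ForceAssumptions N κ α f Φ Ψ g) {u v : Space N → Space N} {w h : L2 N}
    (hu : w =ᵐ[volume] u) (hv : h =ᵐ[volume] v) {kw kh : GradSpace N δ α}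
    (hw : IsNonlocalGrad w kw) (hh : IsNonlocalGrad h kh) :
    pairingK δ f u v = -κ * ⟪kw, kh⟫ + perturbForm δ (perturbKernel κ α f) w h := by
  have hwE : nonlocalEnergy δ α w < ∞ := by rw [hw.nonlocalEnergy_eq]; exact ENNReal.ofReal_lt_top
  have hhE : nonlocalEnergy δ α h < ∞ := by rw [hh.nonlocalEnergy_eq]; exact ENNReal.ofReal_lt_top
  have i1 := integrable_singular_form hwE hhE
  have i2 := (hf.isPerturbation δ).integrable w h
  have i3 := (i1.const_mul (2 * κ)).add i2
  have e1 : ∫ x : Space N, ∫ y in Metric.ball (0 : Space N) δ,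
      inner ℝ (f y (u x - u (x - y))) (v x - v (x - y))
      = ∫ p, (2 * κ * ((‖p.2‖ ^ ((N : ℝ) + 2 * α))⁻¹ * ⟪pairDiff w p, pairDiff h p⟫)
        + ⟪perturbKernel κ α f p.2 (pairDiff w p), pairDiff h p⟫) ∂pairMeasure N δ := by
    have := integral_prod _ i3
    simp only [Pi.add_apply] at this
    rw [pairMeasure, this]
    refine integral_congr_ae ?_
    filter_upwards [hu, hv] with x h1 h2
    refine integral_congr_ae (ae_restrict_of_ae ?_)
    have q := (Measure.measurePreserving_sub_left volume x).quasiMeasurePreserving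
    filter_upwards [q.ae hu, q.ae hv, ae_force_eq κ α f] with y h3 h4 h5
    simp only [pairDiff, h1, h2, h3, h4]
    rw [h5, inner_add_left, real_inner_smul_left, mul_assoc (2 * κ)]
  have e2 : ⟪kw, kh⟫ = ∫ p, (‖p.2‖ ^ ((N : ℝ) + 2 * α))⁻¹ * ⟪pairDiff w p, pairDiff h p⟫
      ∂pairMeasure N δ := by
    rw [pairMeasure, integral_prod_symm _ i1]
    simp only [integral_const_mul, ← inner_diffOp_eq_integral]
    rw [← integral_kernelMeasure, L2.inner_def]
    refine integral_congr_ae ?_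
    filter_upwards [hw, hh] with y h1 h2
    rw [h1, h2]
  -- The factor 2κ from the gradient of κ|u|² meets the prefactor -1/2 of the pairing, leaving -κ.
  rw [pairingK, e1, integral_add (i1.const_mul (2 * κ)) i2, integral_const_mul, ← e2, perturbForm]
  ring

/-- Mollifications of continuous functions with compact support are test functions. -/
theorem exists_contDiff_mollify (b : ContDiffBump (0 : Space N)) {v : Space N → Space N}
    (hv : Continuous v) (hvc : HasCompactSupport v) {w : L2 N} (hw : w =ᵐ[volume] v) :
    ∃ m : Space N → Space N, ContDiff ℝ (⊤ : ℕ∞) m ∧ HasCompactSupport m ∧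
      mollify b w =ᵐ[volume] m := by
  set m : Space N → Space N :=
    convolution (b.normed volume) v (ContinuousLinearMap.lsmul ℝ ℝ) volume with hm
  have hm1 : ContDiff ℝ (⊤ : ℕ∞) m :=
    b.hasCompactSupport_normed.contDiff_convolution_left _ b.contDiff_normed hv.locallyIntegrable
  have hm2 : HasCompactSupport m := b.hasCompactSupport_normed.convolution _ hvc
  have hmL : MemLp m 2 volume := hm1.continuous.memLp_of_hasCompactSupport hm2
  refine ⟨m, hm1, hm2, ?_⟩
  suffices h : mollify b w = hmL.toLp m by rw [h]; exact hmL.coeFn_toLp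
  -- The L²-valued integral is compared with the pointwise convolution by testing against an
  -- arbitrary z and using Fubini.
  refine ext_inner_right ℝ fun z => ?_
  have htr : ∀ t, ⟪transl t w, z⟫ = ∫ x, ⟪v (x - t), z x⟫ := fun t => by
    rw [L2.inner_def]
    refine integral_congr_ae ?_
    filter_upwards [transl_coeFn t w,
      (measurePreserving_sub_right volume t).quasiMeasurePreserving.ae hw] with x h1 h2
    rw [h1, h2]
  have hzm : Measurable z := (Lp.stronglyMeasurable z).measurable
  have hint : Integrable (Function.uncurry fun t x => b.normed volume t * ⟪v (x - t), z x⟫)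
      ((volume : Measure (Space N)).prod volume) := by
    have hvm := hv.measurable
    have hbm := (b.continuous_normed (μ := volume)).measurable
    have hmeas : Measurable (Function.uncurry fun t x => b.normed volume t * ⟪v (x - t), z x⟫) := by
      unfold Function.uncurry
      exact (hbm.comp measurable_fst).mul ((hvm.comp (by fun_prop)).inner (hzm.comp measurable_snd))
    refine ⟨hmeas.aestronglyMeasurable, ?_⟩
    rw [HasFiniteIntegral, lintegral_prod _ hmeas.enorm.aemeasurable]
    have hb : ∀ t, ∫⁻ x, ‖b.normed volume t * ⟪v (x - t), z x⟫‖ₑ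
        ≤ ‖b.normed volume t‖ₑ * (‖w‖ₑ * ‖z‖ₑ) := fun t => by
      calc _ ≤ ∫⁻ x, ‖b.normed volume t‖ₑ * (‖v (x - t)‖ₑ * ‖z x‖ₑ) := by
            refine lintegral_mono fun x => ?_
            rw [enorm_mul]
            gcongr
            exact enorm_inner_le_mul _ _
        _ = ‖b.normed volume t‖ₑ * ∫⁻ x, ‖v (x - t)‖ₑ * ‖z x‖ₑ :=
            lintegral_const_mul' _ _ enorm_ne_top
        _ ≤ _ := by
            gcongr
            have h1 := lintegral_mul_sq_le (μ := volume) (f := fun x => ‖v (x - t)‖ₑ)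
              (g := fun x => ‖z x‖ₑ) (by fun_prop) hzm.enorm.aemeasurable
            have h2 : ∫⁻ x, ‖v (x - t)‖ₑ ^ 2 = ‖w‖ₑ ^ 2 := by
              rw [lintegral_sub_right_eq_self (fun x => ‖v x‖ₑ ^ 2) t, Lp_enorm_sq]
              refine lintegral_congr_ae ?_
              filter_upwards [hw] with x hx
              rw [hx]
            rw [h2, ← Lp_enorm_sq, ← mul_pow] at h1
            exact (ENNReal.pow_le_pow_left_iff two_ne_zero).1 h1
    refine lt_of_le_of_lt (lintegral_mono hb) ?_
    rw [lintegral_mul_const' _ _ (by finiteness)]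
    exact ENNReal.mul_lt_top b.integrable_normed.2 (by finiteness)
  rw [inner_mollify_eq_integral]
  simp only [htr, ← integral_const_mul]
  rw [integral_integral_swap hint, L2.inner_def]
  refine integral_congr_ae ?_
  filter_upwards [hmL.coeFn_toLp] with x hx
  have hi : Integrable (fun t => b.normed volume t • v (x - t)) :=
    (b.continuous_normed.smul (hv.comp (by fun_prop))).integrable_of_hasCompactSupport
      b.hasCompactSupport_normed.smul_right
  rw [hx, hm, convolution_def, real_inner_comm]
  simp only [ContinuousLinearMap.lsmul_apply]
  rw [← integral_inner hi]
  refine integral_congr_ae (.of_forall fun t => ?_)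
  dsimp only
  rw [real_inner_smul_right, real_inner_comm]

end Force

/-! ### From weak solutions to mollified evolution equations in L² -/

section WeakSolution

open Filter Topology
open scoped RealInnerProductSpace

/-- By second countability every open set is a countable union of balls, whose preimages are
sublevel sets of the distance functions. -/
theorem measurable_of_dist {X M : Type*} [MeasurableSpace X] [PseudoMetricSpace M]
    [SecondCountableTopology M] [MeasurableSpace M] [BorelSpace M] {c : X → M}
    (h : ∀ a, Measurable fun x => dist (c x) a) : Measurable c := by
  refine measurable_of_isOpen fun U hU => ?_
  choose! ε hε hεU using Metric.isOpen_iff.1 hU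
  obtain ⟨T, hT, hTU⟩ := TopologicalSpace.isOpen_iUnion_countable
    (fun x : U => Metric.ball (x : M) (ε x)) fun _ => Metric.isOpen_ball
  have e : U = ⋃ x ∈ T, Metric.ball (x : M) (ε x) := by
    rw [hTU]
    refine Subset.antisymm (fun x hx => mem_iUnion.2 ⟨⟨x, hx⟩, Metric.mem_ball_self (hε x hx)⟩) ?_
    exact iUnion_subset fun x => hεU x x.2
  rw [e, preimage_iUnion₂]
  exact .biUnion hT fun x _ => measurableSet_lt (h x) measurable_const

variable {N : ℕ} {δ κ α : ℝ} {f : Space N → Space N → Space N} {Φ Ψ : Space N → Space N → ℝ}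
  {g : Space N → ℝ}

/-- Jointly measurable functions define strongly measurable curves in `L²`. -/
theorem exists_stronglyMeasurable_L2 {v : ℝ × Space N → Space N} (hv : StronglyMeasurable v) :
    ∃ c : ℝ → L2 N, StronglyMeasurable c ∧
      ∀ t, MemLp (fun x => v (t, x)) 2 volume → c t =ᵐ[volume] fun x => v (t, x) := by
  classical
  have hs : ∀ t, StronglyMeasurable fun x => v (t, x) := fun t =>
    hv.comp_measurable measurable_prodMk_left
  have hG : ∀ a : L2 N, Measurable fun t => ∫⁻ x, ‖v (t, x) - a x‖ₑ ^ 2 := fun a => by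
    have ha : Measurable a := (Lp.stronglyMeasurable a).measurable
    have hm := hv.measurable
    have : Measurable fun p : ℝ × Space N => ‖v p - a p.2‖ₑ ^ 2 :=
      ((hm.sub (ha.comp measurable_snd)).enorm).pow_const 2
    exact this.lintegral_prod_right'
  set A : Set ℝ := {t | MemLp (fun x => v (t, x)) 2 volume} with hA
  have hAm : MeasurableSet A := by
    have e : A = {t | ∫⁻ x, ‖v (t, x) - (0 : L2 N) x‖ₑ ^ 2 < ∞} := by
      ext t
      have h0 : ∫⁻ x, ‖v (t, x) - (0 : L2 N) x‖ₑ ^ 2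
          = eLpNorm (fun x => v (t, x)) 2 volume ^ 2 := by
        rw [eLpNorm_two_sq]
        refine lintegral_congr_ae ?_
        filter_upwards [Lp.coeFn_zero (Space N) 2 (volume : Measure (Space N))] with x hx
        rw [hx, Pi.zero_apply, sub_zero]
      rw [mem_ofPred_eq, mem_ofPred_eq, h0, ENNReal.pow_lt_top_iff]
      simp [MemLp, (hs t).aestronglyMeasurable]
    rw [e]
    exact measurableSet_lt (hG 0) measurable_const
  refine ⟨fun t => if h : t ∈ A then MemLp.toLp _ h else 0, ?_, fun t ht => ?_⟩
  · let : MeasurableSpace (L2 N) := borel _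
    have : BorelSpace (L2 N) := ⟨rfl⟩
    have : Fact ((2 : ℝ≥0∞) ≠ ∞) := ⟨ENNReal.ofNat_ne_top⟩
    -- L² is separable, so measurability of the distances to fixed elements is enough, and those are
    -- integrals in x handled by Tonelli.
    refine Measurable.stronglyMeasurable (measurable_of_dist fun a => ?_)
    have hd : ∀ t, dist (if h : t ∈ A then MemLp.toLp _ h else 0 : L2 N) a
        = if t ∈ A then ((∫⁻ x, ‖v (t, x) - a x‖ₑ ^ 2) ^ (1 / 2 : ℝ)).toReal else dist 0 a := by
      intro t
      by_cases ht : t ∈ A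
      · rw [dif_pos ht, if_pos ht, dist_edist, edist_eq_enorm_sub]
        congr 1
        have : ‖(MemLp.toLp _ ht : L2 N) - a‖ₑ ^ 2 = ∫⁻ x, ‖v (t, x) - a x‖ₑ ^ 2 := by
          rw [Lp_enorm_sq]
          refine lintegral_congr_ae ?_
          filter_upwards [Lp.coeFn_sub (MemLp.toLp _ ht : L2 N) a, MemLp.coeFn_toLp ht]
            with x h1 h2
          rw [h1, Pi.sub_apply, h2]
        rw [← this, ← ENNReal.rpow_natCast, ← ENNReal.rpow_mul]
        norm_num
      · rw [dif_neg ht, if_neg ht]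
    simp only [hd]
    exact Measurable.ite hAm ((hG a).pow_const _).ennreal_toReal measurable_const
  · have : t ∈ A := ht
    simp only [dif_pos this]
    exact MemLp.coeFn_toLp _

/-- An element of `𝓧` as a curve in `L²`. -/
theorem MemX.exists_curve {u : ℝ → Space N → Space N} (hu : MemX δ α u) :
    ∃ c : ℝ → L2 N, LocBounded c ∧ ∀ᵐ t ∂volume.restrict (Ioi (0 : ℝ)),
      c t =ᵐ[volume] u t ∧ nonlocalEnergy δ α (c t) < ∞ := by
  set v := hu.measurable.mk _ with hv
  obtain ⟨c, hc, hcv⟩ := exists_stronglyMeasurable_L2 hu.measurable.stronglyMeasurable_mk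
  -- Countably many time horizons are used, so that a single null set serves all of them.
  have hb : ∀ n : ℕ, ∃ C : ℝ≥0, ∀ᵐ t, t ∈ Ioo (0 : ℝ) (n + 1) → wNorm δ α (u t) ≤ C := fun n => by
    obtain ⟨C, hC⟩ := hu.bounded (n + 1) (by positivity)
    exact ⟨C, (ae_restrict_iff' measurableSet_Ioo).1 hC⟩
  choose C hC using hb
  have h1 : ∀ᵐ t ∂volume.restrict (Ioi (0 : ℝ)), (fun x => v (t, x)) =ᵐ[volume] u t := by
    filter_upwards [Measure.ae_ae_of_ae_prod hu.measurable.ae_eq_mk] with t ht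
    filter_upwards [ht] with x hx
    exact hx.symm
  have h2 : ∀ᵐ t ∂volume.restrict (Ioi (0 : ℝ)), c t =ᵐ[volume] u t ∧
      ∀ n : ℕ, t < n + 1 → wNorm δ α (u t) ≤ C n := by
    filter_upwards [h1, ae_restrict_of_ae (ae_all_iff.2 hC), ae_restrict_mem measurableSet_Ioi]
      with t ht hCt ht0
    have hn : ∀ n : ℕ, t < n + 1 → wNorm δ α (u t) ≤ C n := fun n hn => hCt n ⟨ht0, hn⟩
    refine ⟨(hcv t ⟨?_, ?_⟩).trans ht, hn⟩
    · exact (hu.measurable.stronglyMeasurable_mk.comp_measurable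
        measurable_prodMk_left).aestronglyMeasurable
    · obtain ⟨n, hnt⟩ := exists_nat_gt t
      rw [eLpNorm_congr_ae ht]
      exact (le_self_add.trans (hn n (by linarith))).trans_lt ENNReal.coe_lt_top
  -- Extension by zero to t ≤ 0 gives the bounds on symmetric intervals that `LocBounded` demands.
  refine ⟨(Ioi 0).indicator c, ⟨(hc.indicator measurableSet_Ioi).aestronglyMeasurable,
    fun T => ?_⟩, ?_⟩
  · obtain ⟨n, hnT⟩ := exists_nat_gt T
    refine ⟨C n, (C n).2, ?_⟩
    filter_upwards [(ae_restrict_iff' measurableSet_Ioi).1 h2] with t ht htT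
    by_cases ht0 : t ∈ Ioi (0 : ℝ)
    · obtain ⟨h3, h4⟩ := ht ht0
      rw [indicator_of_mem ht0]
      have h5 := le_self_add.trans (h4 n (by linarith [le_abs_self t]))
      rw [← eLpNorm_congr_ae h3, ← Lp.enorm_def] at h5
      exact_mod_cast (enorm_le_coe.1 h5)
    · rw [indicator_of_notMem ht0, norm_zero]
      exact (C n).2
  · filter_upwards [h2, ae_restrict_mem measurableSet_Ioi] with t ht ht0
    rw [indicator_of_mem ht0, nonlocalEnergy_congr ht.1]
    refine ⟨ht.1, ?_⟩
    obtain ⟨n, hnt⟩ := exists_nat_gt t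
    have h5 := (le_add_self.trans (ht.2 n (by linarith))).trans_lt ENNReal.coe_lt_top
    exact (ENNReal.rpow_lt_top_iff_of_pos (by norm_num)).1 h5

theorem pairingK_smul (δ : ℝ) (f : Space N → Space N → Space N) (u v : Space N → Space N) (a : ℝ) :
    pairingK δ f u (fun x => a • v x) = a * pairingK δ f u v := by
  simp only [pairingK, ← smul_sub, real_inner_smul_right, integral_const_mul]
  ring

theorem isNonlocalGrad_mollify (hα : α < 1) (b : ContDiffBump (0 : Space N)) (w : L2 N) :
    IsNonlocalGrad (mollify b w) (gradMollify δ hα b w) :=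
  gradMollify_coeFn hα b w

/-- One of the two mollifiers on z moves over to w. Hence the elastic form tested with a doubly
mollified element involves the bounded operator T*T only. -/
theorem IsNonlocalGrad.inner_gradMollify {w : L2 N} {k : GradSpace N δ α}
    (h : IsNonlocalGrad w k) (hα : α < 1) (b : ContDiffBump (0 : Space N)) (z : L2 N) :
    ⟪k, gradMollify δ hα b (mollify b z)⟫ = ⟪gradMollify δ hα b w, gradMollify δ hα b z⟫ := by
  rw [L2.inner_def, L2.inner_def]
  refine integral_congr_ae ?_
  filter_upwards [h, gradMollify_coeFn hα b (mollify b z), gradMollify_coeFn hα b w,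
    gradMollify_coeFn hα b z] with y h1 h2 h3 h4
  rw [h1, h2, h3, h4, diffOp_mollify, diffOp_mollify, diffOp_mollify, inner_mollify_left]

theorem dense_continuous_compactSupport :
    Dense {k : L2 N | ∃ v : Space N → Space N, Continuous v ∧ HasCompactSupport v ∧
      k =ᵐ[volume] v} := by
  refine Metric.dense_iff.2 fun w ε hε => ?_
  obtain ⟨v, hvc, hv, hvC, hvL⟩ := (Lp.memLp w).exists_hasCompactSupport_eLpNorm_sub_le
    (by norm_num) (ε := ENNReal.ofReal (ε / 2)) (by simpa using hε)
  refine ⟨hvL.toLp v, ?_, v, hvC, hvc, hvL.coeFn_toLp⟩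
  rw [Metric.mem_ball, dist_comm, dist_edist, Lp.edist_def]
  rw [eLpNorm_congr_ae ((EventuallyEq.refl _ _).sub hvL.coeFn_toLp)]
  exact (ENNReal.toReal_le_of_le_ofReal (by positivity) hv).trans_lt (by linarith)

theorem isTestFunction_smul {η : ℝ → ℝ} (hη : ContDiff ℝ (⊤ : ℕ∞) η) (hηc : HasCompactSupport η)
    {m : Space N → Space N} (hm : ContDiff ℝ (⊤ : ℕ∞) m) (hmc : HasCompactSupport m) :
    IsTestFunction fun t x => η t • m x where
  smooth := (hη.comp contDiff_fst).smul (hm.comp contDiff_snd)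
  compact := by
    refine HasCompactSupport.of_support_subset_isCompact (hηc.isCompact.prod hmc.isCompact) ?_
    rintro ⟨t, x⟩ h
    simp only [Function.mem_support, Function.uncurry, ne_eq, smul_eq_zero, not_or] at h
    exact ⟨subset_tsupport _ h.1, subset_tsupport _ h.2⟩

/-- The weak equation tested with a product of functions of time and space. -/
theorem IsWeakSolution.equation_smul {u₀ v₀ : Space N → Space N} {u : ℝ → Space N → Space N}
    (hu : IsWeakSolution δ α f u₀ v₀ u) {η : ℝ → ℝ} (hη : ContDiff ℝ (⊤ : ℕ∞) η)
    (hηc : HasCompactSupport η) {m : Space N → Space N} (hm : ContDiff ℝ (⊤ : ℕ∞) m)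
    (hmc : HasCompactSupport m) :
    ∫ t in Ioi (0 : ℝ), (iteratedDeriv 2 η t * (∫ x, ⟪u t x, m x⟫) - η t * pairingK δ f (u t) m)
      = η 0 * (∫ x, ⟪v₀ x, m x⟫) - deriv η 0 * ∫ x, ⟪u₀ x, m x⟫ := by
  have h := hu.equation _ (isTestFunction_smul hη hηc hm hmc)
  have e1 : ∀ t x, iteratedDeriv 2 (fun s => η s • m x) t = iteratedDeriv 2 η t • m x :=
    fun t x => iteratedDeriv_smul_const (hη.of_le ENat.LEInfty.out).contDiffAt _
  have e2 : ∀ x, deriv (fun s => η s • m x) 0 = deriv η 0 • m x := fun x =>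
    deriv_smul_const (hη.differentiable (by simp) 0) _
  simp only [e1, e2, pairingK_smul, real_inner_smul_right, integral_const_mul] at h
  linarith

/-- For k continuous with compact support, R²k has a smooth compactly supported representative, so
η(t) R²k is admissible. By self-adjointness R² passes to c, to the source and to the data; in the
elastic term the two mollifiers split evenly and give κ T*T c. Density of such k in L² turns the
scalar identities into an identity in L². -/
theorem IsWeakSolution.isMollifiedSolution (hf : ForceAssumptions N κ α f Φ Ψ g)
    {P : L2 N → L2 N} (hP : ∀ w h, ⟪P w, h⟫ = perturbForm δ (perturbKernel κ α f) w h)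
    {u₀ v₀ : Space N → Space N} {u : ℝ → Space N → Space N}
    (hu : IsWeakSolution δ α f u₀ v₀ u) {U₀ V₀ : L2 N} (hU₀ : U₀ =ᵐ[volume] u₀)
    (hV₀ : V₀ =ᵐ[volume] v₀) {c : ℝ → L2 N} (hc : LocBounded c)
    (hPc : LocBounded fun t => P (c t))
    (hcu : ∀ᵐ t ∂volume.restrict (Ioi (0 : ℝ)),
      c t =ᵐ[volume] u t ∧ nonlocalEnergy δ α (c t) < ∞) (φ : ℕ → ContDiffBump (0 : Space N)) :
    IsMollifiedSolution (fun n => mollify (φ n)) (fun n => gradMollify δ hf.alpha_lt_one (φ n)) κ c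
      (fun t => P (c t)) U₀ V₀ := by
  refine ⟨hc, hPc, fun n η hη hηc => ?_⟩
  set b := φ n
  have hα := hf.alpha_lt_one
  set T := gradMollify δ hα b with hT
  set r : ℝ → L2 N := fun t => mollify b (mollify b (P (c t))) - κ • T.adjoint (T (c t)) with hr
  have hrb : LocBounded r := ((hPc.clm (mollify b)).clm (mollify b)).sub
    (((hc.clm T).clm T.adjoint).const_smul κ)
  have hRc : LocBounded fun t => mollify b (mollify b (c t)) :=
    (hc.clm (mollify b)).clm (mollify b)
  have hint := (hRc.integrable_weak hrb hη hηc).integrableOn (s := Ioi (0 : ℝ))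
  refine dense_continuous_compactSupport.eq_of_inner_right ℝ fun k hk => ?_
  obtain ⟨v, hv, hvc, hkv⟩ := hk
  obtain ⟨m₁, hm₁, hm₁c, hkm₁⟩ := exists_contDiff_mollify b hv hvc hkv
  obtain ⟨m, hm, hmc, hkm⟩ := exists_contDiff_mollify b hm₁.continuous hm₁c hkm₁
  have hL2 : ∀ {w : L2 N} {w' : Space N → Space N}, w =ᵐ[volume] w' →
      ⟪k, mollify b (mollify b w)⟫ = ∫ x, ⟪w' x, m x⟫ := fun {w w'} hw => by
    rw [← inner_mollify_left, ← inner_mollify_left, real_inner_comm, L2.inner_def]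
    refine integral_congr_ae ?_
    filter_upwards [hw, hkm] with x h1 h2
    rw [h1, h2]
  rw [← integral_inner hint, inner_sub_right, real_inner_smul_right, real_inner_smul_right,
    hL2 hV₀, hL2 hU₀, ← hu.equation_smul hη hηc hm hmc]
  refine integral_congr_ae ?_
  filter_upwards [hcu] with t ⟨ht, htE⟩
  obtain ⟨kw, hkw⟩ := exists_isNonlocalGrad htE
  rw [inner_sub_right, real_inner_smul_right, real_inner_smul_right, hL2 ht,
    pairingK_eq hf ht hkm hkw (isNonlocalGrad_mollify hα b (mollify b k)),
    hkw.inner_gradMollify hα b k, ← hP]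
  congr 2
  rw [hr]
  dsimp only
  rw [inner_sub_right, real_inner_smul_right, ContinuousLinearMap.adjoint_inner_right,
    ← inner_mollify_left, ← inner_mollify_left, real_inner_comm, real_inner_comm (T k)]
  ring

end WeakSolution

/-! ### Gronwall's inequality and stability for the abstract semilinear wave equation -/

section Stability

open Filter Topology
open scoped RealInnerProductSpace

/-- On the half line E coincides with a C¹ integral expression, and exp(-Ct) times that expression
has nonpositive derivative for t > 0. Nothing is assumed on the sign of C or on the regularity of E
for negative times. -/
theorem gronwall_of_integral {E β : ℝ → ℝ} {C : ℝ} (hβ : Continuous β)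
    (hE : ∀ t, 0 ≤ t → E t = E 0 + ∫ s in (0 : ℝ)..t, β s) (hb : ∀ t, 0 < t → β t ≤ C * E t)
    {t : ℝ} (ht : 0 ≤ t) : E t ≤ Real.exp (C * t) * E 0 := by
  set Z : ℝ → ℝ := fun t => Real.exp (-(C * t)) * (E 0 + ∫ s in (0 : ℝ)..t, β s) with hZ
  have hd : ∀ t, HasDerivAt Z (Real.exp (-(C * t)) * (-(C * 1)) * (E 0 + ∫ s in (0 : ℝ)..t, β s)
      + Real.exp (-(C * t)) * β t) t := fun t => by
    have h1 : HasDerivAt (fun t => Real.exp (-(C * t))) (Real.exp (-(C * t)) * (-(C * 1))) t :=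
      (((hasDerivAt_id t).const_mul C).neg).exp
    have h2 : HasDerivAt (fun t => E 0 + ∫ s in (0 : ℝ)..t, β s) (β t) t :=
      (hβ.integral_hasStrictDerivAt 0 t).hasDerivAt.const_add _
    exact h1.mul h2
  have hanti : AntitoneOn Z (Ici 0) := by
    refine antitoneOn_of_deriv_nonpos (convex_Ici 0)
      (fun t _ => (hd t).continuousAt.continuousWithinAt)
      (fun t _ => (hd t).differentiableAt.differentiableWithinAt) fun t ht => ?_
    rw [interior_Ici] at ht
    rw [(hd t).deriv, ← hE t (le_of_lt ht)]
    have h3 := hb t ht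
    have h4 := Real.exp_pos (-(C * t))
    nlinarith
  have h5 := hanti self_mem_Ici ht ht
  simp only [hZ, ← hE t ht, intervalIntegral.integral_same] at h5
  rw [Real.exp_neg, inv_mul_le_iff₀ (Real.exp_pos _)] at h5
  simpa using h5

variable {H K : Type*} [NormedAddCommGroup H] [InnerProductSpace ℝ H] [CompleteSpace H]
  [NormedAddCommGroup K] [InnerProductSpace ℝ K] [CompleteSpace K]
  {R : ℕ → H →L[ℝ] H} {T : ℕ → H →L[ℝ] K} {G : H → K → Prop} {κ : ℝ}

theorem LocBounded.comp_lipschitz {P : H → H} {L : ℝ≥0} (hP : LipschitzWith L P) {c : ℝ → H}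
    (hc : LocBounded c) : LocBounded fun t => P (c t) where
  aesm := hP.continuous.comp_aestronglyMeasurable hc.aesm
  bdd T := by
    obtain ⟨C, hC0, hC⟩ := hc.bdd T
    refine ⟨‖P 0‖ + L * C, by positivity, ?_⟩
    filter_upwards [hC] with s hs hsT
    have h1 := hP.norm_sub_le (c s) 0
    have h2 := norm_le_norm_add_norm_sub' (P (c s)) (P 0)
    have h3 : (L : ℝ) * ‖c s‖ ≤ L * C := by gcongr; exact hs hsT
    rw [sub_zero] at h1
    linarith

theorem IsWeakSecondDeriv.sub {c r c' r' : ℝ → H} {b₀ b₁ b₀' b₁' : H}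
    (h : IsWeakSecondDeriv c r b₀ b₁) (h' : IsWeakSecondDeriv c' r' b₀' b₁')
    (hc : LocBounded c) (hr : LocBounded r) (hc' : LocBounded c') (hr' : LocBounded r') :
    IsWeakSecondDeriv (fun t => c t - c' t) (fun t => r t - r' t) (b₀ - b₀') (b₁ - b₁') := by
  intro η hη hηc
  have e := integral_sub ((hc.integrable_weak hr hη hηc).integrableOn (s := Ioi (0 : ℝ)))
    ((hc'.integrable_weak hr' hη hηc).integrableOn (s := Ioi (0 : ℝ)))
  rw [h η hη hηc, h' η hη hηc] at e
  rw [smul_sub, smul_sub, sub_sub_sub_comm, ← e]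
  refine integral_congr_ae (.of_forall fun t => ?_)
  simp only [smul_sub]
  abel

theorem IsMollifiedSolution.sub {c F c' F' : ℝ → H} {u₀ v₀ u₀' v₀' : H}
    (h : IsMollifiedSolution R T κ c F u₀ v₀) (h' : IsMollifiedSolution R T κ c' F' u₀' v₀') :
    IsMollifiedSolution R T κ (fun t => c t - c' t) (fun t => F t - F' t) (u₀ - u₀')
      (v₀ - v₀') where
  locBounded := h.locBounded.sub h'.locBounded
  locBounded_source := h.locBounded_source.sub h'.locBounded_source
  weak n := by
    have := (h.weak n).sub (h'.weak n) ((h.locBounded.clm (R n)).clm (R n))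
      (h.primitive_vel n).locBounded ((h'.locBounded.clm (R n)).clm (R n))
      (h'.primitive_vel n).locBounded
    simp only [map_sub, smul_sub]
    simp only [sub_sub_sub_comm] at this ⊢
    exact this

theorem eq_of_ae_eq_Ioi {x y : ℝ → H} (hx : Continuous x) (hy : Continuous y)
    (h : ∀ᵐ t, 0 < t → x t = y t) {t : ℝ} (ht : 0 ≤ t) : x t = y t := by
  have h1 : x =ᵐ[volume.restrict (Ioi (0 : ℝ))] y :=
    (ae_restrict_iff' measurableSet_Ioi).2 h
  have h2 := Measure.eqOn_of_ae_eq h1 hx.continuousOn hy.continuousOn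
    (by rw [interior_Ioi, closure_Ioi]; exact Ioi_subset_Ici_self)
  have h3 := h2.closure hx hy
  rw [closure_Ioi] at h3
  exact h3 ht

/-- Stability of the wave equation with a perturbation `P` controlled by the energy. -/
theorem IsMollifier.exists_stability (S : IsMollifier R T G) (hκ : 0 < κ) {P : H → H}
    (hPc : Continuous P) {C : ℝ} (hP : ∀ w w' k, G (w - w') k → ∀ v,
      2 * ⟪P w - P w', v⟫ ≤ C * (‖v‖ ^ 2 + κ * ‖k‖ ^ 2))
    {c c' : ℝ → H} {u₀ v₀ u₀' v₀' : H} {k₀ k₀' k : K}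
    (h : IsMollifiedSolution R T κ c (fun t => P (c t)) u₀ v₀)
    (h' : IsMollifiedSolution R T κ c' (fun t => P (c' t)) u₀' v₀')
    (hk₀ : G u₀ k₀) (hk₀' : G u₀' k₀') (hk : G (u₀ - u₀') k) :
    ∃ V V' : ℝ → H, Continuous V ∧ Continuous V' ∧
      (∀ᵐ t, 0 < t → c t = u₀ + ∫ s in (0 : ℝ)..t, V s) ∧
      (∀ᵐ t, 0 < t → c' t = u₀' + ∫ s in (0 : ℝ)..t, V' s) ∧
      ∀ t, 0 < t → ∃ z, G ((u₀ + ∫ s in (0 : ℝ)..t, V s) - (u₀' + ∫ s in (0 : ℝ)..t, V' s)) z ∧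
        ‖V t - V' t‖ ^ 2 + κ * ‖z‖ ^ 2
          ≤ Real.exp (C * t) * (‖v₀ - v₀'‖ ^ 2 + κ * ‖k‖ ^ 2) := by
  -- The first two applications only supply the velocities of the two solutions. The energy equality
  -- that matters is that of the difference, regarded as a linear solution with source P(c) - P(c').
  obtain ⟨V, -, hV, -, hcV, -⟩ := h.exists_energy_eq S hκ hk₀
  obtain ⟨V', -, hV', -, hcV', -⟩ := h'.exists_energy_eq S hκ hk₀'
  obtain ⟨W, Z, hW, -, hcW, hE⟩ := (h.sub h').exists_energy_eq S hκ hk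
  refine ⟨V, V', hV, hV', hcV, hcV', ?_⟩
  have hd : ∀ {V : ℝ → H} (_ : Continuous V) (a : H) (t : ℝ),
      HasDerivAt (fun t => a + ∫ s in (0 : ℝ)..t, V s) (V t) t := fun hV a t =>
    (hV.integral_hasStrictDerivAt 0 t).hasDerivAt.const_add a
  have hcont : ∀ {V : ℝ → H} (_ : Continuous V) (a : H),
      Continuous (fun t => a + ∫ s in (0 : ℝ)..t, V s) := fun hV a =>
    continuous_iff_continuousAt.2 fun t => (hd hV a t).continuousAt
  set U : ℝ → H := fun t => u₀ + ∫ s in (0 : ℝ)..t, V s with hU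
  set U' : ℝ → H := fun t => u₀' + ∫ s in (0 : ℝ)..t, V' s with hU'
  set D : ℝ → H := fun t => u₀ - u₀' + ∫ s in (0 : ℝ)..t, W s with hD
  have hUD : ∀ t, 0 ≤ t → D t = U t - U' t := fun t ht => by
    refine eq_of_ae_eq_Ioi (hcont hW _) ((hcont hV _).sub (hcont hV' _)) ?_ ht
    filter_upwards [hcV, hcV', hcW] with s h1 h2 h3 hs
    rw [← h3 hs, h1 hs, h2 hs, Pi.sub_apply]
  have hWV : ∀ t, 0 < t → W t = V t - V' t := fun t ht => by
    refine (hd hW (u₀ - u₀') t).unique ?_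
    refine (((hd hV u₀ t).sub (hd hV' u₀' t))).congr_of_eventuallyEq ?_
    filter_upwards [Ioi_mem_nhds ht] with s hs
    exact hUD s (le_of_lt hs)
  set β : ℝ → ℝ := fun s => 2 * ⟪P (U s) - P (U' s), W s⟫ with hβ
  have hβc : Continuous β :=
    (((hPc.comp (hcont hV _)).sub (hPc.comp (hcont hV' _))).inner hW).const_smul (2 : ℝ)
  set E : ℝ → ℝ := fun t => ‖W t‖ ^ 2 + κ * ‖Z t‖ ^ 2 with hEdef
  have hEβ : ∀ t, 0 ≤ t → E t = (‖v₀ - v₀'‖ ^ 2 + κ * ‖k‖ ^ 2) + ∫ s in (0 : ℝ)..t, β s := by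
    intro t ht
    rw [hEdef]
    dsimp only
    rw [(hE t ht).2, hβ, intervalIntegral.integral_const_mul]
    congr 2
    refine intervalIntegral.integral_congr_ae ?_
    filter_upwards [hcV, hcV'] with s h1 h2 hs
    rw [uIoc_of_le ht] at hs
    rw [h1 hs.1, h2 hs.1]
  have hE0 : E 0 = ‖v₀ - v₀'‖ ^ 2 + κ * ‖k‖ ^ 2 := by simpa using hEβ 0 le_rfl
  intro t ht
  refine ⟨Z t, ?_, ?_⟩
  · have := (hE t ht.le).1
    rwa [← hUD t ht.le]
  · rw [← hWV t ht, ← hE0]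
    refine gronwall_of_integral (E := E) hβc (by rwa [hE0]) (fun s hs => hP _ _ _ ?_ _) ht.le
    rw [← hUD s hs.le]
    exact (hE s hs.le).1

end Stability

/-! ### The growth constant of the perturbation; a sequence of shrinking bumps -/

section Main

open Filter Topology
open scoped RealInnerProductSpace

variable {N : ℕ} {δ κ α : ℝ} {g : Space N → ℝ} {k : Space N → Space N → Space N}

theorem growthRate_nonneg (δ α : ℝ) (g : Space N → ℝ) : 0 ≤ growthRate δ α g :=
  integral_nonneg fun y => by positivity

/-- Two bounds on the same weighted difference. Estimating D_y by 2 gives the Lipschitz constant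
2∫g, used for continuity and local boundedness of the source. Bounding it by the energy gives q² ≤
λ‖z‖², hence 2q‖v‖ ≤ λ‖v‖² + ‖z‖². These are two of the four terms of (λ + 1/κ)(‖v‖² + κ‖z‖²), and
the other two are nonnegative. -/
theorem IsPerturbation.exists_lipschitz_operator (hk : IsPerturbation δ k g) (hκ : 0 < κ)
    (hα : 0 < α) : ∃ P : L2 N → L2 N, (∀ w h, ⟪P w, h⟫ = perturbForm δ k w h) ∧
      (∃ L, LipschitzWith L P) ∧
      ∀ (w w' : L2 N) (z : GradSpace N δ α), IsNonlocalGrad (w - w') z → ∀ v : L2 N,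
        2 * ⟪P w - P w', v⟫ ≤ (growthRate δ α g + 1 / κ) * (‖v‖ ^ 2 + κ * ‖z‖ ^ 2) := by
  obtain ⟨P, hP, hPL⟩ := hk.exists_operator
  refine ⟨P, hP, ⟨2 * (∫⁻ y in Metric.ball (0 : Space N) δ, ‖g y‖ₑ).toNNReal, ?_⟩, ?_⟩
  · refine LipschitzWith.of_dist_le_mul fun w w' => ?_
    rw [dist_eq_norm, dist_eq_norm]
    refine (hPL w w').trans ?_
    refine (ENNReal.toReal_mono (ENNReal.mul_ne_top (by finiteness) hk.lintegral_enorm_lt_top.ne)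
      (hk.weightedDiff_le _)).trans_eq ?_
    rw [ENNReal.toReal_mul, ENNReal.toReal_mul, toReal_enorm, NNReal.coe_mul]
    simp only [ENNReal.toReal_ofNat, NNReal.coe_ofNat, ENNReal.coe_toNNReal_eq_toReal]
    ring
  · intro w w' z hz v
    set q := (weightedDiff δ g (w - w')).toReal with hq
    have hl := growthRate_nonneg δ α g
    have h1 : q ^ 2 ≤ growthRate δ α g * ‖z‖ ^ 2 := by
      have := hk.weightedDiff_sq_le hα (w - w')
      rw [hz.nonlocalEnergy_eq, ← ENNReal.ofReal_mul hl] at this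
      have h2 := ENNReal.toReal_le_of_le_ofReal (by positivity) this
      rwa [ENNReal.toReal_pow] at h2
    have h3 : ⟪P w - P w', v⟫ ≤ q * ‖v‖ :=
      (real_inner_le_norm _ _).trans (by gcongr; exact hPL w w')
    have h4 : 2 * (q * ‖v‖) ≤ growthRate δ α g * ‖v‖ ^ 2 + ‖z‖ ^ 2 := by
      refine abs_le_of_sq_le_sq' ?_ (by positivity) |>.2
      have h5 : q ^ 2 * ‖v‖ ^ 2 ≤ growthRate δ α g * ‖z‖ ^ 2 * ‖v‖ ^ 2 := by gcongr
      nlinarith [sq_nonneg (growthRate δ α g * ‖v‖ ^ 2 - ‖z‖ ^ 2)]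
    have h6 : (growthRate δ α g + 1 / κ) * (‖v‖ ^ 2 + κ * ‖z‖ ^ 2)
        = growthRate δ α g * ‖v‖ ^ 2 + ‖z‖ ^ 2 + growthRate δ α g * (κ * ‖z‖ ^ 2)
          + 1 / κ * ‖v‖ ^ 2 := by
      field_simp
      ring
    have h7 : 0 ≤ growthRate δ α g * (κ * ‖z‖ ^ 2) + 1 / κ * ‖v‖ ^ 2 := by positivity
    rw [h6]
    linarith

theorem exists_bump_tendsto_zero (N : ℕ) : ∃ φ : ℕ → ContDiffBump (0 : Space N),
    Tendsto (fun n => (φ n).rOut) atTop (𝓝 0) :=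
  ⟨fun n => ⟨1 / ((n : ℝ) + 1) / 2, 1 / ((n : ℝ) + 1), by positivity, half_lt_self (by positivity)⟩,
    tendsto_one_div_add_atTop_nhds_zero_nat⟩

end Main

end Peridynamics

end

/-! ### The uniqueness and stability theorem -/

open Peridynamics in
theorem theorem2p4 (N : ℕ) (δ κ α : ℝ) (hδ : 0 < δ)
    (f : Peridynamics.Space N → Peridynamics.Space N → Peridynamics.Space N)
    (Φ Ψ : Peridynamics.Space N → Peridynamics.Space N → ℝ) (g : Peridynamics.Space N → ℝ)
    (hf : Peridynamics.ForceAssumptions N κ α f Φ Ψ g)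
    (u₀ v₀ u₀' v₀' : Peridynamics.Space N → Peridynamics.Space N)
    (hdata : Peridynamics.FiniteEnergyData δ Φ u₀ v₀)
    (hdata' : Peridynamics.FiniteEnergyData δ Φ u₀' v₀')
    (u u' : ℝ → Peridynamics.Space N → Peridynamics.Space N)
    (hu : Peridynamics.IsWeakSolution δ α f u₀ v₀ u)
    (hu' : Peridynamics.IsWeakSolution δ α f u₀' v₀' u') :
    (∃ U U' : ℝ → Lp (Peridynamics.Space N) 2 (volume : Measure (Peridynamics.Space N)),
      Peridynamics.IsContinuousRep u U ∧ Peridynamics.IsContinuousRep u' U' ∧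
      ∀ t : ℝ, 0 < t →
        DifferentiableAt ℝ U t ∧ DifferentiableAt ℝ U' t ∧
        ENNReal.ofReal (‖deriv U t - deriv U' t‖ ^ 2)
            + ENNReal.ofReal κ * Peridynamics.nonlocalEnergy δ α (fun x => U t x - U' t x)
          ≤ ENNReal.ofReal (Real.exp ((Peridynamics.growthRate δ α g + 1 / κ) * t))
            * (eLpNorm (fun x => v₀ x - v₀' x) 2 volume ^ 2
              + ENNReal.ofReal κ
                * Peridynamics.nonlocalEnergy δ α (fun x => u₀ x - u₀' x))) ∧
    (u₀ =ᵐ[volume] u₀' → v₀ =ᵐ[volume] v₀' →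
      ∀ᵐ t ∂volume.restrict (Ioi (0 : ℝ)), u t =ᵐ[volume] u' t) := by
  have hκ := hf.kappa_pos
  obtain ⟨φ, hφ⟩ := exists_bump_tendsto_zero N
  obtain ⟨P, hP, ⟨L, hPL⟩, hPg⟩ :=
    (hf.isPerturbation δ).exists_lipschitz_operator (κ := κ) hκ hf.alpha_pos
  obtain ⟨c, hc, hcu⟩ := hu.memX.exists_curve
  obtain ⟨c', hc', hcu'⟩ := hu'.memX.exists_curve
  set U₀ : L2 N := hdata.memLp_u₀.toLp u₀ with hU₀
  set V₀ : L2 N := hdata.memLp_v₀.toLp v₀ with hV₀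
  set U₀' : L2 N := hdata'.memLp_u₀.toLp u₀' with hU₀'
  set V₀' : L2 N := hdata'.memLp_v₀.toLp v₀' with hV₀'
  have eU : U₀ =ᵐ[volume] u₀ := MemLp.coeFn_toLp _
  have eV : V₀ =ᵐ[volume] v₀ := MemLp.coeFn_toLp _
  have eU' : U₀' =ᵐ[volume] u₀' := MemLp.coeFn_toLp _
  have eV' : V₀' =ᵐ[volume] v₀' := MemLp.coeFn_toLp _
  have sub_coeFn : ∀ {w z : L2 N} {w' z' : Space N → Space N}, w =ᵐ[volume] w' →
      z =ᵐ[volume] z' → (w - z : L2 N) =ᵐ[volume] fun x => w' x - z' x :=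
      fun {w z w' z'} h1 h2 => by
    filter_upwards [Lp.coeFn_sub w z, h1, h2] with x h3 h4 h5
    rw [h3, Pi.sub_apply, h4, h5]
  obtain ⟨k₀, hk₀⟩ := exists_isNonlocalGrad (δ := δ) (α := α) (w := U₀)
    (by rw [nonlocalEnergy_congr eU]; exact hdata.nonlocalEnergy_lt_top hf)
  obtain ⟨k₀', hk₀'⟩ := exists_isNonlocalGrad (δ := δ) (α := α) (w := U₀')
    (by rw [nonlocalEnergy_congr eU']; exact hdata'.nonlocalEnergy_lt_top hf)
  have hk := hk₀.sub hk₀'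
  obtain ⟨V, V', hV, hV', hcV, hcV', hE⟩ :=
    (isMollifier_mollify (δ := δ) hf.alpha_lt_one hφ).exists_stability hκ hPL.continuous hPg
      (hu.isMollifiedSolution hf hP eU eV hc (hc.comp_lipschitz hPL) hcu φ)
      (hu'.isMollifiedSolution hf hP eU' eV' hc' (hc'.comp_lipschitz hPL) hcu' φ) hk₀ hk₀' hk
  have hd : ∀ {V : ℝ → L2 N} (_ : Continuous V) (a : L2 N) (t : ℝ),
      HasDerivAt (fun t => a + ∫ s in (0 : ℝ)..t, V s) (V t) t := fun hV a t =>
    (hV.integral_hasStrictDerivAt 0 t).hasDerivAt.const_add a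
  have rep : ∀ {V c : ℝ → L2 N} {u : ℝ → Space N → Space N} {a : L2 N}, Continuous V →
      (∀ᵐ t, 0 < t → c t = a + ∫ s in (0 : ℝ)..t, V s) →
      (∀ᵐ t ∂volume.restrict (Ioi (0 : ℝ)), c t =ᵐ[volume] u t ∧ nonlocalEnergy δ α (c t) < ∞) →
      IsContinuousRep u fun t => a + ∫ s in (0 : ℝ)..t, V s := fun {V c u a} hV h1 h2 => by
    refine ⟨fun t _ => (hd hV a t).continuousAt.continuousWithinAt, ?_⟩
    filter_upwards [h2, (ae_restrict_iff' measurableSet_Ioi).2 h1] with t h3 h4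
    rw [← h4]
    exact h3.1
  have hr := rep hV hcV hcu
  have hr' := rep hV' hcV' hcu'
  have key : ∀ t, 0 < t →
      ENNReal.ofReal (‖V t - V' t‖ ^ 2) + ENNReal.ofReal κ * nonlocalEnergy δ α
        (((U₀ + ∫ s in (0 : ℝ)..t, V s) - (U₀' + ∫ s in (0 : ℝ)..t, V' s) : L2 N))
      ≤ ENNReal.ofReal (Real.exp ((growthRate δ α g + 1 / κ) * t))
        * (eLpNorm (fun x => v₀ x - v₀' x) 2 volume ^ 2
          + ENNReal.ofReal κ * nonlocalEnergy δ α (fun x => u₀ x - u₀' x)) := by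
    intro t ht
    obtain ⟨z, hz, hzE⟩ := hE t ht
    rw [← nonlocalEnergy_congr (sub_coeFn eU eU'), ← eLpNorm_congr_ae (sub_coeFn eV eV'),
      ← Lp.enorm_def, hz.nonlocalEnergy_eq, hk.nonlocalEnergy_eq, ← ofReal_norm,
      ← ENNReal.ofReal_pow (norm_nonneg _), ← ENNReal.ofReal_mul hκ.le, ← ENNReal.ofReal_mul hκ.le,
      ← ENNReal.ofReal_add (by positivity) (by positivity),
      ← ENNReal.ofReal_add (by positivity) (by positivity), ← ENNReal.ofReal_mul (by positivity)]
    exact ENNReal.ofReal_le_ofReal hzE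
  refine ⟨⟨_, _, hr, hr', fun t ht =>
    ⟨(hd hV _ t).differentiableAt, (hd hV' _ t).differentiableAt, ?_⟩⟩, fun h₀ h₁ => ?_⟩
  · rw [(hd hV _ t).deriv, (hd hV' _ t).deriv]
    rw [← nonlocalEnergy_congr (sub_coeFn (ae_eq_refl _) (ae_eq_refl _))]
    exact key t ht
  -- For equal data the estimate has right side zero. Only its velocity part is used: the positions
  -- agree by integrating equal velocities from a common initial value.
  · have hVV : ∀ t, 0 < t → V t = V' t := fun t ht => by
      have h2 : nonlocalEnergy δ α (fun x => u₀ x - u₀' x) = 0 := by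
        rw [nonlocalEnergy_congr (w' := fun _ => 0) (by
          filter_upwards [h₀] with x hx
          rw [hx, sub_self])]
        simp [nonlocalEnergy]
      have h3 : eLpNorm (fun x => v₀ x - v₀' x) 2 volume = 0 := by
        rw [eLpNorm_congr_ae (g := fun _ => 0) (by
          filter_upwards [h₁] with x hx
          rw [hx, sub_self])]
        simp
      have h4 := key t ht
      rw [h2, h3] at h4
      simp only [ne_eq, OfNat.ofNat_ne_zero, not_false_eq_true, zero_pow, mul_zero, add_zero,
        nonpos_iff_eq_zero, add_eq_zero, ENNReal.ofReal_eq_zero] at h4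
      have h5 : ‖V t - V' t‖ = 0 := by nlinarith [norm_nonneg (V t - V' t), h4.1]
      exact sub_eq_zero.1 (norm_eq_zero.1 h5)
    have hUU : U₀ = U₀' := Lp.ext (eU.trans (h₀.trans eU'.symm))
    filter_upwards [hr.ae_eq, hr'.ae_eq, ae_restrict_mem measurableSet_Ioi] with t h2 h3 ht
    have h4 : ∫ s in (0 : ℝ)..t, V s = ∫ s in (0 : ℝ)..t, V' s := by
      refine intervalIntegral.integral_congr_ae (.of_forall fun s hs => hVV s ?_)
      rw [uIoc_of_le (le_of_lt ht)] at hs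
      exact hs.1
    refine h2.symm.trans ?_
    rw [hUU, h4]
    exact h3
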